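/- Let $d\ge 0$ be an integer. For an integer matrix $R\in M_d(\mathbb Z)$ all of whose complex eigenvalues have modulus strictly greater than $1$ (an \emph{expansive} matrix) and finite sets $B,L\subset\mathbb Z^d$ with $\#B=\#L=N$, say that $(R,B,L)$ is a \emph{Hadamard triple} if the matrix $$H=\frac1{\sqrt N}\left[e^{2\pi i\langle R^{-1}b,\ell\rangle}\right]_{\ell\in L,\,b\in B}$$ satisfies $H^*H=I$. For $B\neq\emptyset$ let $\mu=\mu(R,B)$ be the unique Borel probability measure on $\mathbb R^d$ such that $$\mu(E)=\sum_{b\in B}\frac1N\,\mu(\tau_b^{-1}(E))\quad\text{for all Borel sets }E\subset\mathbb R^d,\qquad \tau_b(x)=R^{-1}(x+b),$$ and let $\widehat\mu(\xi)=\int e^{-2\pi i\langle\xi,x\rangle}\,d\mu(x)$. For $n\ge 1$ put $B_n=\{\sum_{j=0}^{n-1}R^jb_j: b_j\in B\}$. \textbf{Theorem.} Let $(R,B,L)$ be a Hadamard triple. Let $n_1,n_2,\dots$ be positive integers, $m_0=0$ and $m_k=n_1+\dots+n_k$ for $k\ge1$, and for each $k\ge 1$ let $J_{n_k}\subset\mathbb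 Z^d$ be a finite set (which may depend on the index $k$ and not only on the value $n_k$) such that $0\in J_{n_k}$ and $(R^{n_k},B_{n_k},J_{n_k})$ is a Hadamard triple. Put $$\Lambda_k=J_{n_1}+(R^T)^{m_1}J_{n_2}+(R^T)^{m_2}J_{n_3}+\dots+(R^T)^{m_{k-1}}J_{n_k}\quad(k\ge1),\qquad \Lambda=\bigcup_{k=1}^\infty\Lambda_k .$$ If $$\delta(\Lambda):=\inf_{k\ge1}\ \inf_{\lambda\in\Lambda_k}\left|\widehat\mu\big((R^T)^{-m_k}\lambda\big)\right|^2>0,$$ then $\Lambda$ is a spectrum of $\mu(R,B)$; that is, the exponentials $x\mapsto e^{2\pi i\langle\lambda,x\rangle}$, $\lambda\in\Lambda$, form an orthonormal basis of $L^2(\mu)$. -/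

import Mathlib

open MeasureTheory ProbabilityTheory Filter Topology

noncomputable section

/-- An integer vector, viewed as a point of Euclidean space. -/
def intVec {d : ℕ} (v : Fin d → ℤ) : EuclideanSpace ℝ (Fin d) :=
  WithLp.toLp 2 fun i => (v i : ℝ)

/-- The linear map `x ↦ M⁻¹ x` of Euclidean space, for an integer matrix `M`
(the inverse is that of the real matrix `M`). -/
def invAct {d : ℕ} (M : Matrix (Fin d) (Fin d) ℤ) :
    EuclideanSpace ℝ (Fin d) →L[ℝ] EuclideanSpace ℝ (Fin d) :=
  Matrix.toEuclideanCLM (n := Fin d) (𝕜 := ℝ) (M.map (Int.cast : ℤ → ℝ))⁻¹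

/-- All complex eigenvalues have modulus strictly greater than one. -/
def IsExpansive {d : ℕ} (R : Matrix (Fin d) (Fin d) ℤ) : Prop :=
  ∀ z ∈ spectrum ℂ (R.map (Int.cast : ℤ → ℂ)), 1 < ‖z‖

/-- The matrix `N^{-1/2} [exp (2 π i ⟨R⁻¹ b, ℓ⟩)]`, with rows `ℓ ∈ L` and columns `b ∈ B`,
where `N = #B`. -/
def hadamardMatrix {d : ℕ} (R : Matrix (Fin d) (Fin d) ℤ) (B L : Finset (Fin d → ℤ)) :
    Matrix L B ℂ :=
  fun l b => ((1 / Real.sqrt (B.card : ℝ) : ℝ) : ℂ) *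
    Complex.exp (2 * Real.pi * Complex.I *
      ((inner ℝ (invAct R (intVec b.1)) (intVec l.1) : ℝ) : ℂ))

/-- Hadamard triples of an expansive integer matrix and two finite sets of integer vectors of
the same cardinality. -/
structure IsHadamardTriple {d : ℕ} (R : Matrix (Fin d) (Fin d) ℤ)
    (B L : Finset (Fin d → ℤ)) : Prop where
  expansive : IsExpansive R
  card_eq : B.card = L.card
  unitary : (hadamardMatrix R B L).conjTranspose * hadamardMatrix R B L = 1

/-- The digit set `B_n = B + R B + ⋯ + R^{n-1} B`. -/
def digitSums {d : ℕ} (R : Matrix (Fin d) (Fin d) ℤ) (B : Finset (Fin d → ℤ)) (n : ℕ) :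
    Finset (Fin d → ℤ) :=
  (Fintype.piFinset fun _ : Fin n => B).image fun b =>
    ∑ j : Fin n, (R ^ (j : ℕ)).mulVec (b j)

/-- The maps of the iterated function system, `τ_b x = R⁻¹ (x + b)`. -/
def ifsMap {d : ℕ} (R : Matrix (Fin d) (Fin d) ℤ) (b : Fin d → ℤ)
    (x : EuclideanSpace ℝ (Fin d)) : EuclideanSpace ℝ (Fin d) :=
  invAct R (x + intVec b)

/-- `μ` is a Borel probability measure with `μ(E) = ∑_{b ∈ B} N⁻¹ μ(τ_b⁻¹ E)` for all Borel sets
`E`, where `N = #B`. -/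
structure IsSelfAffineMeasure {d : ℕ} (R : Matrix (Fin d) (Fin d) ℤ)
    (B : Finset (Fin d → ℤ)) (μ : Measure (EuclideanSpace ℝ (Fin d))) : Prop where
  prob : IsProbabilityMeasure μ
  invariant : ∀ E : Set (EuclideanSpace ℝ (Fin d)), MeasurableSet E →
    μ E = ∑ b ∈ B, (B.card : ENNReal)⁻¹ * μ (ifsMap R b ⁻¹' E)

open Classical in
/-- The self-affine measure `μ(R, B)`: the unique measure as above. It exists and is unique when
`R` is expansive and `B` is nonempty (see `isSelfAffineMeasure_selfAffineMeasure` and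
`IsSelfAffineMeasure.unique`); the value in other cases is irrelevant. -/
def selfAffineMeasure {d : ℕ} (R : Matrix (Fin d) (Fin d) ℤ) (B : Finset (Fin d → ℤ)) :
    Measure (EuclideanSpace ℝ (Fin d)) :=
  if h : ∃ μ, IsSelfAffineMeasure R B μ then h.choose else 0

/-- The Fourier transform `μ̂(ξ) = ∫ exp (-2 π i ⟨ξ, x⟩) dμ(x)` of a measure. -/
def fourierMeasure {d : ℕ} (μ : Measure (EuclideanSpace ℝ (Fin d)))
    (ξ : EuclideanSpace ℝ (Fin d)) : ℂ :=
  ∫ x, Complex.exp (-2 * Real.pi * Complex.I * ((inner ℝ ξ x : ℝ) : ℂ)) ∂μ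

/-- `Λ` is a spectrum of `μ`: the exponentials `x ↦ exp (2 π i ⟨λ, x⟩)`, `λ ∈ Λ`, form an
orthonormal basis of `L²(μ)`. -/
def IsSpectrum {d : ℕ} (μ : Measure (EuclideanSpace ℝ (Fin d)))
    (Λ : Set (EuclideanSpace ℝ (Fin d))) : Prop :=
  ∃ e : HilbertBasis Λ ℂ (Lp ℂ 2 μ), ∀ l : Λ,
    (e l : EuclideanSpace ℝ (Fin d) → ℂ) =ᵐ[μ] fun x =>
      Complex.exp (2 * Real.pi * Complex.I * ((inner ℝ l.1 x : ℝ) : ℂ))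

/-- The partial sums `m_k = n_1 + ⋯ + n_k`. Sequences are indexed from `0`: the value `n i` is the
length `n_{i+1}`, and `J i` below is the block `J_{n_{i+1}}`. -/
def partialLen (n : ℕ → ℕ) (k : ℕ) : ℕ := ∑ i ∈ Finset.range k, n i

/-- `Λ_k = J_{n_1} + (Rᵀ)^{m_1} J_{n_2} + ⋯ + (Rᵀ)^{m_{k-1}} J_{n_k}`. -/
def concatBlocks {d : ℕ} (R : Matrix (Fin d) (Fin d) ℤ) (n : ℕ → ℕ)
    (J : ℕ → Finset (Fin d → ℤ)) (k : ℕ) : Finset (Fin d → ℤ) :=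
  (Fintype.piFinset fun i : Fin k => J i).image fun j =>
    ∑ i : Fin k, (R.transpose ^ partialLen n i).mulVec (j i)

/-- `Λ = ⋃_{k ≥ 1} Λ_k`. -/
def concatUnion {d : ℕ} (R : Matrix (Fin d) (Fin d) ℤ) (n : ℕ → ℕ)
    (J : ℕ → Finset (Fin d → ℤ)) : Set (Fin d → ℤ) :=
  ⋃ k : ℕ, (concatBlocks R n J (k + 1) : Set (Fin d → ℤ))

/-- `δ(Λ) = inf_{k ≥ 1} inf_{λ ∈ Λ_k} |μ̂((Rᵀ)^{-m_k} λ)|²`. -/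
def deltaLower {d : ℕ} (μ : Measure (EuclideanSpace ℝ (Fin d)))
    (R : Matrix (Fin d) (Fin d) ℤ) (n : ℕ → ℕ) (J : ℕ → Finset (Fin d → ℤ)) : ℝ :=
  ⨅ k : ℕ, ⨅ l : concatBlocks R n J (k + 1),
    ‖fourierMeasure μ (invAct (R.transpose ^ partialLen n (k + 1)) (intVec l.1))‖ ^ 2

/-! Existence and uniqueness of the self-affine measure. -/

theorem IsExpansive.summable_norm_pow {d : ℕ} {R : Matrix (Fin d) (Fin d) ℤ}
    (hR : IsExpansive R) : Summable fun k : ℕ => ‖invAct R ^ k‖ := by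
  rcases Nat.eq_zero_or_pos d with rfl | hd
  · have : (fun k : ℕ => ‖invAct R ^ k‖) = 0 := by
      funext k
      have : invAct R ^ k = 0 := Subsingleton.elim _ _
      simp [this]
    rw [this]; exact summable_zero
  have : Nonempty (Fin d) := ⟨⟨0, hd⟩⟩
  set C : Matrix (Fin d) (Fin d) ℂ := R.map (Int.cast : ℤ → ℂ) with hC
  set M : Matrix (Fin d) (Fin d) ℝ := R.map (Int.cast : ℤ → ℝ) with hM
  have hCM : C = M.map (algebraMap ℝ ℂ) := by ext i j; simp [hC, hM]
  have hCu : IsUnit C := by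
    have h0 : (0 : ℂ) ∉ spectrum ℂ C := fun h => by
      have := hR 0 h
      simp at this
      linarith
    exact spectrum.zero_notMem_iff ℂ |>.1 h0
  have hMu : IsUnit M.det := by
    have h1 := (Matrix.isUnit_iff_isUnit_det C).1 hCu
    have h2 : C.det = algebraMap ℝ ℂ M.det := by
      rw [hCM]; exact ((algebraMap ℝ ℂ).map_det M).symm
    rw [h2] at h1
    rw [isUnit_iff_ne_zero] at h1 ⊢
    intro h; exact h1 (by simp [h])
  have hinv : C⁻¹ = M⁻¹.map (algebraMap ℝ ℂ) := by
    apply Matrix.inv_eq_left_inv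
    rw [hCM, ← Matrix.map_mul, Matrix.nonsing_inv_mul _ hMu]
    simp
  let D : EuclideanSpace ℂ (Fin d) →L[ℂ] EuclideanSpace ℂ (Fin d) :=
    Matrix.toEuclideanCLM (n := Fin d) (𝕜 := ℂ) C⁻¹
  -- the spectral radius of the inverse is smaller than one
  have hspec : spectralRadius ℂ D < ((1 : NNReal) : ENNReal) := by
    refine spectrum.spectralRadius_lt_of_forall_lt D ?_
    intro z hz
    have hz' : z ∈ spectrum ℂ C⁻¹ := by
      have := AlgEquiv.spectrum_eq
        (Matrix.toEuclideanCLM (n := Fin d) (𝕜 := ℂ)).toAlgEquiv (C⁻¹)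
      rw [← this]; exact hz
    have hCCi : C⁻¹ = ((hCu.unit⁻¹ : (Matrix (Fin d) (Fin d) ℂ)ˣ) : Matrix (Fin d) (Fin d) ℂ) := by
      apply Matrix.inv_eq_left_inv
      exact hCu.val_inv_mul
    have hz0 : z ≠ 0 := by
      rintro rfl
      rw [hCCi] at hz'
      exact spectrum.zero_notMem ℂ (Units.isUnit _) hz'
    have hzinv : z⁻¹ ∈ spectrum ℂ C := by
      have h3 := (spectrum.inv_mem_iff (R := ℂ) (r := Units.mk0 z hz0) (a := hCu.unit⁻¹)).1
        (by rw [← hCCi]; exact hz')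
      simpa using h3
    have h4 := hR _ hzinv
    rw [norm_inv] at h4
    have h5 : ‖z‖ < 1 := by
      have hp : 0 < ‖z‖ := norm_pos_iff.2 hz0
      exact (one_lt_inv₀ hp).1 h4
    exact_mod_cast h5
  have hG := spectrum.pow_nnnorm_pow_one_div_tendsto_nhds_spectralRadius D
  obtain ⟨r, hr1, hr2⟩ := ENNReal.lt_iff_exists_nnreal_btwn.1 hspec
  have hr2' : r < 1 := by exact_mod_cast hr2
  have hev : ∀ᶠ k : ℕ in atTop, ‖D ^ k‖ ≤ (r : ℝ) ^ k := by
    filter_upwards [hG.eventually_lt_const hr1, eventually_gt_atTop 0] with k hk hk0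
    have hk' : (‖D ^ k‖₊ : ENNReal) < (r : ENNReal) ^ (k : ℝ) := by
      have hkp : (0 : ℝ) < k := by exact_mod_cast hk0
      have := ENNReal.rpow_lt_rpow hk hkp
      rwa [← ENNReal.rpow_mul, one_div, inv_mul_cancel₀ hkp.ne', ENNReal.rpow_one] at this
    rw [ENNReal.rpow_natCast] at hk'
    have : ‖D ^ k‖₊ < r ^ k := by exact_mod_cast hk'
    exact_mod_cast this.le
  have hsD : Summable fun k : ℕ => ‖D ^ k‖ := by
    refine Summable.of_norm_bounded_eventually_nat (g := fun k => (r : ℝ) ^ k)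
      (summable_geometric_of_lt_one r.2 (by exact_mod_cast hr2')) ?_
    filter_upwards [hev] with k hk
    simpa using hk
  -- comparison of real and complex operator norms
  refine Summable.of_nonneg_of_le (fun _ => norm_nonneg _) (fun k => ?_) hsD
  let ι : EuclideanSpace ℝ (Fin d) → EuclideanSpace ℂ (Fin d) :=
    fun x => WithLp.toLp 2 fun i => (x i : ℂ)
  have hι : ∀ x, ‖ι x‖ = ‖x‖ := by
    intro x
    simp [ι, EuclideanSpace.norm_eq]
  have hstep : ∀ x, ι (invAct R x) = D (ι x) := by
    intro x
    ext i
    simp [ι, D, invAct, hinv, Matrix.mulVec, dotProduct, ← hM]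
  have hpow : ∀ k x, ι ((invAct R ^ k) x) = (D ^ k) (ι x) := by
    intro k
    induction k with
    | zero => intro x; simp
    | succ k ih =>
      intro x
      rw [pow_succ, pow_succ, mul_apply_eq_comp, mul_apply_eq_comp,
        ih, hstep]
  refine ContinuousLinearMap.opNorm_le_bound _ (norm_nonneg _) fun x => ?_
  rw [← hι, hpow, ← hι x]
  exact ContinuousLinearMap.le_opNorm _ _

theorem measurable_ifsMap {d : ℕ} (R : Matrix (Fin d) (Fin d) ℤ) (b : Fin d → ℤ) :
    Measurable (ifsMap R b) := by
  unfold ifsMap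
  exact ((invAct R).continuous.comp (continuous_id.add continuous_const)).measurable

/-- The law of `∑_{k ≥ 1} R^{-k} b_k`, with independent `b_k` distributed uniformly on `B`, is
self-affine. -/
theorem exists_isSelfAffineMeasure {d : ℕ} {R : Matrix (Fin d) (Fin d) ℤ}
    {B : Finset (Fin d → ℤ)} (hR : IsExpansive R) (hB : B.Nonempty) :
    ∃ μ, IsSelfAffineMeasure R B μ := by
  classical
  set A := invAct R with hA
  have hsum : Summable fun k : ℕ => ‖A ^ k‖ := hR.summable_norm_pow
  have hN0 : (B.card : ENNReal) ≠ 0 := by simpa using hB.ne_empty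
  have hNt : (B.card : ENNReal) ≠ ⊤ := ENNReal.natCast_ne_top _
  let ν : Measure B := (B.card : ENNReal)⁻¹ • ∑ b : B, Measure.dirac b
  have hν : ∀ s : Set B, MeasurableSet s → ν s =
      ∑ b : B, (B.card : ENNReal)⁻¹ * s.indicator 1 b := by
    intro s hs
    simp only [ν, Measure.smul_apply, Measure.finsetSum_apply, smul_eq_mul, Finset.mul_sum]
    refine Finset.sum_congr rfl fun b _ => ?_
    rw [Measure.dirac_apply' _ hs]
  have hνp : IsProbabilityMeasure ν := ⟨by
    rw [hν _ MeasurableSet.univ]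
    simp [ENNReal.mul_inv_cancel hN0 hNt]⟩
  let P : Measure (ℕ → B) := Measure.infinitePi fun _ => ν
  let cons : B → (ℕ → B) → (ℕ → B) := fun b ω n => Nat.casesOn n b ω
  have hcons : ∀ b, Measurable (cons b) := by
    intro b
    refine measurable_pi_lambda _ fun n => ?_
    cases n with
    | zero => exact measurable_const
    | succ n => exact measurable_pi_apply n
  have hP : (∑ b : B, (B.card : ENNReal)⁻¹ • P.map (cons b)) = P := by
    refine Measure.eq_infinitePi _ fun s t ht => ?_
    obtain ⟨m, hm⟩ : ∃ m, s ⊆ Finset.range (m + 1) :=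
      ⟨s.sup id, fun i hi => Finset.mem_range.2 (Nat.lt_succ_of_le (Finset.le_sup (f := id) hi))⟩
    let t' : ℕ → Set B := fun i => if i ∈ s then t i else Set.univ
    have ht' : ∀ i, MeasurableSet (t' i) := by
      intro i; by_cases hi : i ∈ s <;> simp [t', hi, ht i]
    have hpi : Set.pi (s : Set ℕ) t = Set.pi (Finset.range (m + 1) : Set ℕ) t' := by
      ext ω
      simp only [Set.mem_pi]
      constructor
      · intro h i _
        by_cases hi' : i ∈ s
        · simpa [t', hi'] using h i hi'
        · simp [t', hi']
      · intro h i hi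
        have := h i (hm hi)
        have hi2 : i ∈ s := hi
        simpa [t', hi2] using this
    have hprod : ∏ i ∈ s, ν (t i) = ∏ i ∈ Finset.range (m + 1), ν (t' i) := by
      rw [← Finset.prod_subset hm]
      · refine Finset.prod_congr rfl fun i hi => by simp [t', hi]
      · intro i _ hi
        simp [t', hi]
    have hmeas : MeasurableSet (Set.pi (Finset.range (m + 1) : Set ℕ) t') :=
      MeasurableSet.pi (Set.to_countable _) fun i _ => ht' i
    rw [hpi, hprod, Finset.prod_range_succ', hν _ (ht' 0), Finset.mul_sum]
    simp only [Measure.finsetSum_apply, Measure.smul_apply, smul_eq_mul]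
    refine Finset.sum_congr rfl fun b _ => ?_
    rw [Measure.map_apply (hcons b) hmeas]
    by_cases hb : b ∈ t' 0
    · have : cons b ⁻¹' Set.pi (Finset.range (m + 1) : Set ℕ) t' =
          Set.pi (Finset.range m : Set ℕ) fun i => t' (i + 1) := by
        ext ω
        simp only [Set.mem_preimage, Set.mem_pi, Finset.coe_range, Set.mem_Iio]
        constructor
        · intro h i hi
          exact h (i + 1) (by omega)
        · intro h i hi
          cases i with
          | zero => exact hb
          | succ i => exact h i (by omega)
      rw [this, Measure.infinitePi_pi _ fun i _ => ht' (i + 1)]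
      simp [hb, mul_comm]
    · have : cons b ⁻¹' Set.pi (Finset.range (m + 1) : Set ℕ) t' = ∅ := by
        ext ω
        simp only [Set.mem_preimage, Set.mem_pi, Finset.coe_range, Set.mem_Iio,
          Set.mem_empty_iff_false, iff_false]
        intro h
        exact hb (h 0 (by omega))
      rw [this]
      simp [hb]
  -- the random series
  obtain ⟨K, hK⟩ : ∃ K : ℝ, ∀ b : B, ‖intVec b.1‖ ≤ K :=
    ⟨∑ b : B, ‖intVec b.1‖, fun b =>
      Finset.single_le_sum (f := fun b : B => ‖intVec b.1‖) (fun _ _ => norm_nonneg _)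
        (Finset.mem_univ b)⟩
  let X : (ℕ → B) → EuclideanSpace ℝ (Fin d) :=
    fun ω => ∑' k : ℕ, (A ^ (k + 1)) (intVec (ω k).1)
  have hXs : ∀ ω : ℕ → B, Summable fun k : ℕ => (A ^ (k + 1)) (intVec (ω k).1) := by
    intro ω
    refine Summable.of_norm_bounded (g := fun k => ‖A ^ (k + 1)‖ * K)
      (((summable_nat_add_iff 1).2 hsum).mul_right K) fun k => ?_
    exact (ContinuousLinearMap.le_opNorm _ _).trans
      (mul_le_mul_of_nonneg_left (hK _) (norm_nonneg _))
  have hXm : Measurable X := by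
    refine measurable_of_tendsto_metrizable (f := fun (m : ℕ) (ω : ℕ → B) =>
      ∑ k ∈ Finset.range m, (A ^ (k + 1)) (intVec (ω k).1)) (fun m => ?_) ?_
    · refine Finset.measurable_sum _ fun k _ => ?_
      have : Measurable fun b : B => (A ^ (k + 1)) (intVec b.1) := measurable_of_finite _
      exact this.comp (measurable_pi_apply k)
    · rw [tendsto_pi_nhds]
      intro ω
      exact (hXs ω).hasSum.tendsto_sum_nat
  have hXc : ∀ b ω, X (cons b ω) = ifsMap R b.1 (X ω) := by
    intro b ω
    have h1 : X (cons b ω) = (A ^ (0 + 1)) (intVec b.1) +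
        ∑' k : ℕ, (A ^ (k + 1 + 1)) (intVec (ω k).1) := (hXs (cons b ω)).tsum_eq_zero_add
    have h2 : A (X ω) = ∑' k : ℕ, A ((A ^ (k + 1)) (intVec (ω k).1)) :=
      ContinuousLinearMap.map_tsum A (hXs ω)
    have h3 : ∀ k : ℕ, (A ^ (k + 1 + 1)) (intVec (ω k).1) = A ((A ^ (k + 1)) (intVec (ω k).1)) := by
      intro k
      rw [pow_succ', mul_apply_eq_comp]
    rw [h1, ifsMap, ← hA, map_add, h2]
    simp only [h3, zero_add, pow_one]
    rw [add_comm]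
  refine ⟨P.map X, Measure.isProbabilityMeasure_map hXm.aemeasurable, fun E hE => ?_⟩
  have key : P (X ⁻¹' E) = ∑ b : B, (B.card : ENNReal)⁻¹ * P (X ⁻¹' (ifsMap R b.1 ⁻¹' E)) := by
    conv_lhs => rw [← hP]
    simp only [Measure.finsetSum_apply, Measure.smul_apply, smul_eq_mul]
    refine Finset.sum_congr rfl fun b _ => ?_
    rw [Measure.map_apply (hcons b) (hXm hE)]
    congr 2
    ext ω
    simp [hXc]
  rw [Measure.map_apply hXm hE, key, ← Finset.sum_coe_sort B]
  refine Finset.sum_congr rfl fun b _ => ?_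
  rw [Measure.map_apply hXm (measurable_ifsMap R b.1 hE)]

theorem IsSelfAffineMeasure.unique {d : ℕ} {R : Matrix (Fin d) (Fin d) ℤ}
    {B : Finset (Fin d → ℤ)} (hR : IsExpansive R)
    {μ ν : Measure (EuclideanSpace ℝ (Fin d))} (hμ : IsSelfAffineMeasure R B μ)
    (hν : IsSelfAffineMeasure R B ν) : μ = ν := by
  classical
  have := hμ.prob
  have := hν.prob
  set T := ContinuousLinearMap.adjoint (invAct R) with hT
  have hB : (B.card : ENNReal) ≠ 0 := by
    intro h
    have h0 : B = ∅ := by simpa using h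
    have := hμ.invariant Set.univ MeasurableSet.univ
    simp [h0] at this
  have hchar : ∀ ρ, IsSelfAffineMeasure R B ρ → ∀ t, charFun ρ t =
      ((B.card : ℂ)⁻¹ * ∑ b ∈ B, Complex.exp ((inner ℝ (intVec b) (T t) : ℝ) * Complex.I)) *
        charFun ρ (T t) := by
    intro ρ hρ t
    have := hρ.prob
    have hρ' : ρ = ∑ b ∈ B, (B.card : ENNReal)⁻¹ • ρ.map (ifsMap R b) := by
      ext E hE
      rw [hρ.invariant E hE]
      simp only [Measure.finsetSum_apply, Measure.smul_apply, smul_eq_mul]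
      refine Finset.sum_congr rfl fun b _ => ?_
      rw [Measure.map_apply (measurable_ifsMap R b) hE]
    have hint : ∀ b, Integrable (fun x => Complex.exp ((inner ℝ x t : ℝ) * Complex.I))
        (ρ.map (ifsMap R b)) := by
      intro b
      have : IsProbabilityMeasure (ρ.map (ifsMap R b)) :=
        Measure.isProbabilityMeasure_map (measurable_ifsMap R b).aemeasurable
      refine Integrable.of_bound (C := 1) (by fun_prop) (ae_of_all _ fun x => ?_)
      rw [Complex.norm_exp_ofReal_mul_I]
    have hone : ∀ b, ∫ x, Complex.exp ((inner ℝ x t : ℝ) * Complex.I) ∂(ρ.map (ifsMap R b)) =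
        Complex.exp ((inner ℝ (intVec b) (T t) : ℝ) * Complex.I) * charFun ρ (T t) := by
      intro b
      rw [integral_map (measurable_ifsMap R b).aemeasurable (by fun_prop), charFun_apply,
        ← integral_const_mul]
      refine integral_congr_ae (ae_of_all _ fun x => ?_)
      simp only [ifsMap]
      rw [← ContinuousLinearMap.adjoint_inner_right, ← hT, inner_add_left, ← Complex.exp_add]
      congr 1
      push_cast
      ring
    conv_lhs => rw [charFun_apply, hρ']
    rw [integral_finsetSum_measure fun b _ =>
      (hint b).smul_measure (ENNReal.inv_ne_top.2 hB)]
    simp only [integral_smul_measure, hone]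
    rw [Finset.mul_sum, Finset.sum_mul]
    refine Finset.sum_congr rfl fun b _ => ?_
    simp [mul_assoc]
  have hle : ∀ t, ‖charFun μ t - charFun ν t‖ ≤ ‖charFun μ (T t) - charFun ν (T t)‖ := by
    intro t
    rw [hchar μ hμ t, hchar ν hν t, ← mul_sub, norm_mul]
    refine mul_le_of_le_one_left (norm_nonneg _) ?_
    rw [norm_mul, norm_inv, Complex.norm_natCast]
    have hBp : (0 : ℝ) < B.card := by
      have : B.card ≠ 0 := by exact_mod_cast hB
      positivity
    rw [inv_mul_le_iff₀ hBp, mul_one]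
    refine (norm_sum_le _ _).trans ?_
    simp only [Complex.norm_exp_ofReal_mul_I]
    simp
  have hle' : ∀ (k : ℕ) t, ‖charFun μ t - charFun ν t‖ ≤
      ‖charFun μ ((T ^ k) t) - charFun ν ((T ^ k) t)‖ := by
    intro k
    induction k with
    | zero => intro t; simp
    | succ k ih =>
      intro t
      refine (ih t).trans ?_
      rw [pow_succ', mul_apply_eq_comp]
      exact hle _
  have hTk : ∀ k : ℕ, ‖T ^ k‖ = ‖invAct R ^ k‖ := by
    intro k
    have h := LinearIsometryEquiv.norm_map
      (ContinuousLinearMap.adjoint (𝕜 := ℝ) (E := EuclideanSpace ℝ (Fin d))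
        (F := EuclideanSpace ℝ (Fin d))) (invAct R ^ k)
    rw [hT, ← h, ← ContinuousLinearMap.star_eq_adjoint, ← ContinuousLinearMap.star_eq_adjoint,
      star_pow]
  refine Measure.ext_of_charFun (funext fun t => ?_)
  have hlim : Tendsto (fun k : ℕ => (T ^ k) t) atTop (𝓝 0) := by
    refine squeeze_zero_norm (a := fun k => ‖invAct R ^ k‖ * ‖t‖) (fun k => ?_) ?_
    · rw [← hTk]; exact ContinuousLinearMap.le_opNorm _ _
    · simpa using hR.summable_norm_pow.tendsto_atTop_zero.mul_const ‖t‖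
  have hcont : Continuous fun s => ‖charFun μ s - charFun ν s‖ := by fun_prop
  have h0 : Tendsto (fun k : ℕ => ‖charFun μ ((T ^ k) t) - charFun ν ((T ^ k) t)‖) atTop
      (𝓝 0) := by
    have := (hcont.tendsto 0).comp hlim
    have h00 : ‖charFun μ 0 - charFun ν 0‖ = 0 := by simp [charFun_zero]
    rw [h00] at this
    exact this
  have h1 : ‖charFun μ t - charFun ν t‖ ≤ 0 :=
    ge_of_tendsto h0 (Eventually.of_forall fun k => hle' k t)
  exact sub_eq_zero.1 (norm_le_zero_iff.1 h1)

theorem isSelfAffineMeasure_selfAffineMeasure {d : ℕ} {R : Matrix (Fin d) (Fin d) ℤ}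
    {B : Finset (Fin d → ℤ)} (hR : IsExpansive R) (hB : B.Nonempty) :
    IsSelfAffineMeasure R B (selfAffineMeasure R B) := by
  have h := exists_isSelfAffineMeasure hR hB
  rw [selfAffineMeasure, dif_pos h]
  exact h.choose_spec

end

noncomputable section

/-! Write `T` for the inverse of `Rᵀ`. Self-affinity refines the transform: `μ̂(ξ)` is the mask
product of length `m` at `ξ` times `μ̂(T^m ξ)` (`IsSelfAffineMeasure.fourierMeasure_eq_maskProd`). A
Hadamard triple says that the squared moduli of the mask, translated by the dual digits, sum to one.
Since the mask of `B_n` is itself a mask product, the blocks can be chained: for every `ξ` the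
squared mask product of length `m_k` sums to one over `ξ + Λ_k` (`sum_norm_maskProd_concatBlocks`).

Orthogonality comes from taking `ξ = -y` with `y ∈ Λ_k`: the term of `y` is already one, so all
others vanish, and with them `μ̂(x - y)`.

For completeness it suffices, by the Jorgensen–Pedersen criterion (`isSpectrum_of_one_le_tsum`),
that `|μ̂(ξ + λ)|²` sums to at least one over `Λ`. These terms are the pointwise limits of the
squared mask products cut off to `Λ_k`, because `T^{m_k}(ξ + λ)` tends to zero and `μ̂(0) = 1`. Each
cut-off family has sum one, so the only danger is loss of mass in the limit. The bound `δ(Λ) > 0`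
excludes it: uniform continuity of `μ̂` carries the lower bound from `T^{m_k} λ` to `T^{m_k}(ξ +
λ)`, so for large `k` the cut-off terms are at most `(2/δ)|μ̂(ξ + λ)|²`. This majorant is summable
by Bessel's inequality, and dominated convergence concludes. -/

/-! ### Integer vectors and matrices acting on Euclidean space -/

theorem intVec_injective {d : ℕ} : Function.Injective (intVec : (Fin d → ℤ) → _) := by
  intro v w h
  funext i
  have := congrArg (fun x : EuclideanSpace ℝ (Fin d) => x i) h
  simpa [intVec] using this

theorem intVec_add {d : ℕ} (v w : Fin d → ℤ) : intVec (v + w) = intVec v + intVec w := by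
  ext i; simp [intVec]

theorem intVec_zero {d : ℕ} : intVec (0 : Fin d → ℤ) = 0 := by
  ext i; simp [intVec]

theorem inner_intVec_intVec {d : ℕ} (v w : Fin d → ℤ) :
    inner ℝ (intVec v) (intVec w) = ((v ⬝ᵥ w : ℤ) : ℝ) := by
  simp [intVec, PiLp.inner_apply, dotProduct, mul_comm]

/-- The linear map `x ↦ M x` of Euclidean space, for an integer matrix `M`. -/
def matAct {d : ℕ} (M : Matrix (Fin d) (Fin d) ℤ) :
    EuclideanSpace ℝ (Fin d) →L[ℝ] EuclideanSpace ℝ (Fin d) :=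
  Matrix.toEuclideanCLM (n := Fin d) (𝕜 := ℝ) (M.map (Int.cast : ℤ → ℝ))

theorem intVec_mulVec {d : ℕ} (M : Matrix (Fin d) (Fin d) ℤ) (v : Fin d → ℤ) :
    intVec (M.mulVec v) = matAct M (intVec v) := by
  ext i
  simp [intVec, matAct, Matrix.mulVec, dotProduct]

theorem Matrix.map_intCast_pow {d : ℕ} (M : Matrix (Fin d) (Fin d) ℤ) (k : ℕ) :
    (M ^ k).map (Int.cast : ℤ → ℝ) = (M.map (Int.cast : ℤ → ℝ)) ^ k :=
  map_pow (Int.castRingHom ℝ).mapMatrix M k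

theorem invAct_pow {d : ℕ} (M : Matrix (Fin d) (Fin d) ℤ) (k : ℕ) :
    invAct (M ^ k) = invAct M ^ k := by
  rw [invAct, Matrix.map_intCast_pow, ← Matrix.inv_pow', map_pow, invAct]

theorem inner_invAct_left {d : ℕ} (M : Matrix (Fin d) (Fin d) ℤ)
    (x y : EuclideanSpace ℝ (Fin d)) :
    inner ℝ (invAct M x) y = inner ℝ x (invAct M.transpose y) := by
  rw [← ContinuousLinearMap.adjoint_inner_right, ← ContinuousLinearMap.star_eq_adjoint, invAct,
    invAct, ← map_star, Matrix.star_eq_conjTranspose, Matrix.conjTranspose_nonsing_inv,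
    Matrix.conjTranspose_eq_transpose_of_trivial, Matrix.transpose_map]

theorem inner_matAct_left {d : ℕ} (M : Matrix (Fin d) (Fin d) ℤ)
    (x y : EuclideanSpace ℝ (Fin d)) :
    inner ℝ (matAct M x) y = inner ℝ x (matAct M.transpose y) := by
  rw [← ContinuousLinearMap.adjoint_inner_right, ← ContinuousLinearMap.star_eq_adjoint, matAct,
    matAct, ← map_star, Matrix.star_eq_conjTranspose,
    Matrix.conjTranspose_eq_transpose_of_trivial, Matrix.transpose_map]

theorem IsExpansive.det_ne_zero {d : ℕ} {R : Matrix (Fin d) (Fin d) ℤ} (hR : IsExpansive R) :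
    R.det ≠ 0 := by
  intro h
  have h0 : (0 : ℂ) ∉ spectrum ℂ (R.map (Int.cast : ℤ → ℂ)) := fun h => by
    have := hR 0 h
    simp at this
    linarith
  have h1 := (Matrix.isUnit_iff_isUnit_det _).1 (spectrum.zero_notMem_iff ℂ |>.1 h0)
  have h2 : (R.map (Int.cast : ℤ → ℂ)).det = ((R.det : ℤ) : ℂ) :=
    ((Int.castRingHom ℂ).map_det R).symm
  rw [h2, h] at h1
  simp at h1

theorem isUnit_det_map_intCast {d : ℕ} {M : Matrix (Fin d) (Fin d) ℤ} (hM : M.det ≠ 0) :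
    IsUnit (M.map (Int.cast : ℤ → ℝ)).det := by
  have h2 : (M.map (Int.cast : ℤ → ℝ)).det = ((M.det : ℤ) : ℝ) :=
    ((Int.castRingHom ℝ).map_det M).symm
  rw [h2, isUnit_iff_ne_zero]
  exact_mod_cast hM

theorem invAct_matAct {d : ℕ} {M : Matrix (Fin d) (Fin d) ℤ} (hM : M.det ≠ 0)
    (x : EuclideanSpace ℝ (Fin d)) : invAct M (matAct M x) = x := by
  rw [← mul_apply_eq_comp, invAct, matAct, ← map_mul,
    Matrix.nonsing_inv_mul _ (isUnit_det_map_intCast hM), map_one]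
  rfl

theorem matAct_invAct {d : ℕ} {M : Matrix (Fin d) (Fin d) ℤ} (hM : M.det ≠ 0)
    (x : EuclideanSpace ℝ (Fin d)) : matAct M (invAct M x) = x := by
  rw [← mul_apply_eq_comp, invAct, matAct, ← map_mul,
    Matrix.mul_nonsing_inv _ (isUnit_det_map_intCast hM), map_one]
  rfl

/-- Adjoints have equal norms. This transfers the contraction estimate for `R⁻¹` to the dual side,
where frequencies live. -/
theorem norm_invAct_transpose_pow {d : ℕ} (R : Matrix (Fin d) (Fin d) ℤ) (k : ℕ) :
    ‖invAct R.transpose ^ k‖ = ‖invAct R ^ k‖ := by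
  rw [← invAct_pow, ← invAct_pow, ← Matrix.transpose_pow]
  set M := R ^ k
  have : invAct M.transpose = ContinuousLinearMap.adjoint (invAct M) := by
    rw [ContinuousLinearMap.eq_adjoint_iff]
    intro x y
    rw [inner_invAct_left, Matrix.transpose_transpose]
  rw [this, LinearIsometryEquiv.norm_map]

theorem IsExpansive.tendsto_invAct_transpose_pow {d : ℕ} {R : Matrix (Fin d) (Fin d) ℤ}
    (hR : IsExpansive R) (x : EuclideanSpace ℝ (Fin d)) :
    Tendsto (fun k : ℕ => (invAct R.transpose ^ k) x) atTop (𝓝 0) := by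
  refine squeeze_zero_norm (a := fun k => ‖invAct R ^ k‖ * ‖x‖) (fun k => ?_) ?_
  · rw [← norm_invAct_transpose_pow]; exact ContinuousLinearMap.le_opNorm _ _
  · simpa using hR.summable_norm_pow.tendsto_atTop_zero.mul_const ‖x‖

/-! ### Characters -/

/-- The character `x ↦ exp (2 π i ⟨ξ, x⟩)`. -/
def expChar {d : ℕ} (ξ x : EuclideanSpace ℝ (Fin d)) : ℂ :=
  Complex.exp (2 * Real.pi * Complex.I * ((inner ℝ ξ x : ℝ) : ℂ))

theorem expChar_add {d : ℕ} (ξ x y : EuclideanSpace ℝ (Fin d)) :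
    expChar ξ (x + y) = expChar ξ x * expChar ξ y := by
  rw [expChar, expChar, expChar, ← Complex.exp_add, inner_add_right]
  congr 1; push_cast; ring

theorem expChar_comm {d : ℕ} (ξ x : EuclideanSpace ℝ (Fin d)) : expChar ξ x = expChar x ξ := by
  rw [expChar, expChar, real_inner_comm]

theorem expChar_add_left {d : ℕ} (ξ η x : EuclideanSpace ℝ (Fin d)) :
    expChar (ξ + η) x = expChar ξ x * expChar η x := by
  rw [expChar_comm, expChar_add, expChar_comm x, expChar_comm x]

theorem expChar_neg {d : ℕ} (ξ x : EuclideanSpace ℝ (Fin d)) :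
    expChar ξ (-x) = (starRingEnd ℂ) (expChar ξ x) := by
  rw [expChar, expChar, ← Complex.exp_conj, inner_neg_right]
  congr 1
  simp [Complex.conj_ofNat]

theorem expChar_neg_left {d : ℕ} (ξ x : EuclideanSpace ℝ (Fin d)) :
    expChar (-ξ) x = (starRingEnd ℂ) (expChar ξ x) := by
  rw [expChar_comm, expChar_neg, expChar_comm]

theorem norm_expChar {d : ℕ} (ξ x : EuclideanSpace ℝ (Fin d)) : ‖expChar ξ x‖ = 1 := by
  rw [expChar, Complex.norm_exp]
  simp

theorem expChar_zero_left {d : ℕ} (x : EuclideanSpace ℝ (Fin d)) : expChar 0 x = 1 := by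
  simp [expChar]

theorem expChar_intVec {d : ℕ} (v w : Fin d → ℤ) : expChar (intVec v) (intVec w) = 1 := by
  rw [expChar, inner_intVec_intVec, Complex.exp_eq_one_iff]
  exact ⟨v ⬝ᵥ w, by push_cast; ring⟩

@[fun_prop]
theorem continuous_expChar {d : ℕ} (ξ : EuclideanSpace ℝ (Fin d)) : Continuous (expChar ξ) := by
  unfold expChar; fun_prop

/-! ### Masks of digit sets and Hadamard triples -/

/-- The mask `N⁻¹ ∑_{b ∈ B} exp (-2 π i ⟨b, ξ⟩)` of a digit set, with `N = #B`. -/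
def mask {d : ℕ} (B : Finset (Fin d → ℤ)) (ξ : EuclideanSpace ℝ (Fin d)) : ℂ :=
  (B.card : ℂ)⁻¹ * ∑ b ∈ B, expChar (intVec b) (-ξ)

theorem mask_zero {d : ℕ} {B : Finset (Fin d → ℤ)} (hB : B.Nonempty) : mask B 0 = 1 := by
  have : (B.card : ℂ) ≠ 0 := by simpa using hB.ne_empty
  simp [mask, expChar, this]

theorem mask_add_intVec {d : ℕ} (B : Finset (Fin d → ℤ)) (ξ : EuclideanSpace ℝ (Fin d))
    (v : Fin d → ℤ) : mask B (ξ + intVec v) = mask B ξ := by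
  simp only [mask, neg_add, expChar_add]
  congr 1
  refine Finset.sum_congr rfl fun b _ => ?_
  rw [expChar_neg _ (intVec v), expChar_intVec]
  simp

/-- Translates of the mask by the dual digits form a partition of unity. -/
theorem IsHadamardTriple.sum_norm_mask_sq {d : ℕ} {R : Matrix (Fin d) (Fin d) ℤ}
    {B L : Finset (Fin d → ℤ)} (h : IsHadamardTriple R B L) (hB : B.Nonempty)
    (ξ : EuclideanSpace ℝ (Fin d)) :
    ∑ l ∈ L, ‖mask B (invAct R.transpose (ξ + intVec l))‖ ^ 2 = 1 := by
  set H := hadamardMatrix R B L with hH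
  set N : ℝ := (B.card : ℝ) with hN
  have hNp : 0 < N := by rw [hN]; exact_mod_cast hB.card_pos
  set c : ℂ := ((1 / Real.sqrt N : ℝ) : ℂ) with hc
  have hcc : c * c = (B.card : ℂ)⁻¹ := by
    rw [hc, ← Complex.ofReal_mul, one_div, ← mul_inv, Real.mul_self_sqrt hNp.le, hN]
    push_cast; rfl
  have hcs : (starRingEnd ℂ) c = c := Complex.conj_ofReal _
  -- The conjugate masks are the coordinates of `H v`, up to the factor `c`. As `H` is an isometry
  -- and `v` has unimodular entries, `‖H v‖² = ‖v‖² = N`.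
  let v : B → ℂ := fun b => expChar (intVec b.1) (invAct R.transpose ξ)
  have hmask : ∀ l : L, (starRingEnd ℂ) (mask B (invAct R.transpose (ξ + intVec l.1))) =
      c * (H.mulVec v) l := by
    intro l
    simp only [mask, map_mul, map_inv₀, map_natCast, map_sum, Matrix.mulVec, dotProduct,
      ← expChar_neg, neg_neg]
    rw [← hcc, mul_assoc, ← Finset.sum_coe_sort B, Finset.mul_sum]
    congr 1
    refine Finset.sum_congr rfl fun b _ => ?_
    rw [map_add, expChar_add, hH, hadamardMatrix, inner_invAct_left]
    simp only [v, c, N, expChar]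
    ring
  have hnorm : (star (H.mulVec v)) ⬝ᵥ (H.mulVec v) = (B.card : ℂ) := by
    rw [Matrix.star_mulVec, Matrix.dotProduct_mulVec, Matrix.vecMul_vecMul, hH, h.unitary,
      Matrix.vecMul_one]
    have : ∀ b : B, (starRingEnd ℂ) (v b) * v b = 1 := by
      intro b
      rw [mul_comm, Complex.mul_conj, Complex.normSq_eq_norm_sq, norm_expChar]
      simp
    simp [dotProduct, this]
  rw [← Complex.ofReal_inj, ← Finset.sum_coe_sort L]
  push_cast
  have hterm : ∀ l : L, ((‖mask B (invAct R.transpose (ξ + intVec l.1))‖ : ℂ)) ^ 2 =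
      (B.card : ℂ)⁻¹ * (star (H.mulVec v) l * (H.mulVec v) l) := by
    intro l
    rw [← Complex.mul_conj', hmask, ← Complex.conj_conj (mask B _), hmask, map_mul, hcs, ← hcc]
    simp only [Pi.star_apply, RCLike.star_def]
    ring
  rw [Finset.sum_congr rfl fun l _ => hterm l, ← Finset.mul_sum]
  change _ * (star (H.mulVec v) ⬝ᵥ H.mulVec v) = 1
  rw [hnorm]
  refine inv_mul_cancel₀ ?_
  simpa using hB.ne_empty

/-- Distinct digits of a Hadamard triple are incongruent modulo `R ℤ^d`. -/
theorem IsHadamardTriple.digit_eq_of_sub_eq_mulVec {d : ℕ} {R : Matrix (Fin d) (Fin d) ℤ}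
    {B L : Finset (Fin d → ℤ)} (h : IsHadamardTriple R B L) {b b' : Fin d → ℤ}
    (hb : b ∈ B) (hb' : b' ∈ B) {z : Fin d → ℤ} (hz : b = b' + R.mulVec z) : b = b' := by
  by_contra hne
  have h1 := congrFun (congrFun h.unitary ⟨b, hb⟩) ⟨b', hb'⟩
  have h2 := congrFun (congrFun h.unitary ⟨b', hb'⟩) ⟨b', hb'⟩
  rw [Matrix.one_apply_ne (by simpa using hne)] at h1
  rw [Matrix.one_apply_eq] at h2
  -- Congruent digits give equal columns of `H`, whose inner product would then be both `0` and `1`.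
  have hcol : ∀ l : L, hadamardMatrix R B L l ⟨b, hb⟩ = hadamardMatrix R B L l ⟨b', hb'⟩ := by
    intro l
    have := expChar_add_left (invAct R (intVec b')) (intVec z) (intVec l.1)
    rw [expChar_intVec, mul_one] at this
    simp only [hadamardMatrix]
    congr 1
    change expChar _ _ = expChar _ _
    rw [← this, hz, intVec_add, map_add, intVec_mulVec, invAct_matAct h.expansive.det_ne_zero]
  rw [Matrix.mul_apply] at h1 h2
  simp only [Matrix.conjTranspose_apply, hcol] at h1 h2
  rw [h1] at h2
  exact zero_ne_one h2

theorem mem_digitSums {d : ℕ} {R : Matrix (Fin d) (Fin d) ℤ} {B : Finset (Fin d → ℤ)} {n : ℕ}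
    {x : Fin d → ℤ} : x ∈ digitSums R B n ↔
      ∃ b : Fin n → Fin d → ℤ, (∀ j, b j ∈ B) ∧ ∑ j : Fin n, (R ^ (j : ℕ)).mulVec (b j) = x := by
  simp [digitSums]

/-- Splitting off the lowest digit leaves a multiple of `R`, so that congruence modulo `R` can
recover this digit. -/
theorem digitSums_succ {d : ℕ} (R : Matrix (Fin d) (Fin d) ℤ) (B : Finset (Fin d → ℤ)) (n : ℕ) :
    digitSums R B (n + 1) = (B ×ˢ digitSums R B n).image fun p => p.1 + R.mulVec p.2 := by
  have key : ∀ b : Fin (n + 1) → Fin d → ℤ, ∑ j : Fin (n + 1), (R ^ (j : ℕ)).mulVec (b j) =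
      b 0 + R.mulVec (∑ j : Fin n, (R ^ (j : ℕ)).mulVec (b j.succ)) := by
    intro b
    rw [Fin.sum_univ_succ, Matrix.mulVec_sum]
    simp [pow_succ']
  ext x
  simp only [Finset.mem_image, Finset.mem_product, mem_digitSums, Prod.exists]
  constructor
  · rintro ⟨b, hb, rfl⟩
    exact ⟨b 0, _, ⟨hb 0, fun j => b j.succ, fun j => hb _, rfl⟩, (key b).symm⟩
  · rintro ⟨b, y, ⟨hb, c, hc, rfl⟩, rfl⟩
    refine ⟨Fin.cons b c, fun j => ?_, by rw [key]; simp⟩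
    refine Fin.cases ?_ (fun i => ?_) j <;> simp [hb, hc]

theorem digitSums_nonempty {d : ℕ} (R : Matrix (Fin d) (Fin d) ℤ) {B : Finset (Fin d → ℤ)}
    (hB : B.Nonempty) (n : ℕ) : (digitSums R B n).Nonempty := by
  obtain ⟨b, hb⟩ := hB
  exact ⟨_, mem_digitSums.2 ⟨fun _ => b, fun _ => hb, rfl⟩⟩

theorem matAct_injective {d : ℕ} {M : Matrix (Fin d) (Fin d) ℤ} (hM : M.det ≠ 0) :
    Function.Injective (matAct M) :=
  Function.LeftInverse.injective (invAct_matAct hM)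

/-- Incongruence of the digits makes expansions unique, so cardinalities multiply and the character
sum factors. -/
theorem IsHadamardTriple.mask_digitSums_succ {d : ℕ} {R : Matrix (Fin d) (Fin d) ℤ}
    {B L : Finset (Fin d → ℤ)} (h : IsHadamardTriple R B L) (n : ℕ)
    (ξ : EuclideanSpace ℝ (Fin d)) :
    mask (digitSums R B (n + 1)) ξ = mask B ξ * mask (digitSums R B n) (matAct R.transpose ξ) := by
  have hinj : Set.InjOn (fun p : (Fin d → ℤ) × (Fin d → ℤ) => p.1 + R.mulVec p.2)
      (B ×ˢ digitSums R B n : Finset _) := by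
    rintro ⟨b, x⟩ hp ⟨b', x'⟩ hp' heq
    simp only [Finset.coe_product, Set.mem_prod, Finset.mem_coe] at hp hp'
    have heq' : b + R.mulVec x = b' + R.mulVec x' := heq
    have hbb : b = b' := h.digit_eq_of_sub_eq_mulVec (z := x' - x) hp.1 hp'.1 (by
      rw [Matrix.mulVec_sub, ← sub_eq_zero]
      rw [← sub_eq_zero] at heq'
      rw [← heq']; abel)
    subst hbb
    have h2 : R.mulVec x = R.mulVec x' := add_left_cancel heq'
    have h3 := congrArg intVec h2
    rw [intVec_mulVec, intVec_mulVec] at h3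
    rw [intVec_injective (matAct_injective h.expansive.det_ne_zero h3)]
  rw [mask, digitSums_succ, Finset.card_image_of_injOn hinj, Finset.sum_image hinj,
    Finset.card_product, Finset.sum_product, mask, mask]
  push_cast
  rw [mul_inv, mul_mul_mul_comm, Finset.sum_mul_sum]
  congr 1
  refine Finset.sum_congr rfl fun b _ => Finset.sum_congr rfl fun x _ => ?_
  rw [intVec_add, expChar_add_left, intVec_mulVec]
  congr 1
  rw [expChar, expChar, inner_matAct_left, map_neg]

/-- The product `∏_{1 ≤ j ≤ m} mask B ((Rᵀ)^{-j} ξ)`. -/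
def maskProd {d : ℕ} (R : Matrix (Fin d) (Fin d) ℤ) (B : Finset (Fin d → ℤ)) (m : ℕ)
    (ξ : EuclideanSpace ℝ (Fin d)) : ℂ :=
  ∏ j ∈ Finset.range m, mask B ((invAct R.transpose ^ (j + 1)) ξ)

/-- This lets the hypothesis on the triple `(R^n, B_n, J_n)` act on a stretch of `n` factors of the
mask product. -/
theorem IsHadamardTriple.mask_digitSums {d : ℕ} {R : Matrix (Fin d) (Fin d) ℤ}
    {B L : Finset (Fin d → ℤ)} (h : IsHadamardTriple R B L) (n : ℕ)
    (ξ : EuclideanSpace ℝ (Fin d)) :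
    mask (digitSums R B n) ((invAct R.transpose ^ n) ξ) = maskProd R B n ξ := by
  induction n with
  | zero => simp [mask, maskProd, digitSums, intVec_zero, expChar_zero_left]
  | succ n ih =>
    rw [h.mask_digitSums_succ, maskProd, Finset.prod_range_succ, ← maskProd, ← ih, mul_comm]
    congr 2
    rw [pow_succ', mul_apply_eq_comp, matAct_invAct]
    rw [Matrix.det_transpose]; exact h.expansive.det_ne_zero

theorem maskProd_add {d : ℕ} (R : Matrix (Fin d) (Fin d) ℤ) (B : Finset (Fin d → ℤ)) (m n : ℕ)
    (ξ : EuclideanSpace ℝ (Fin d)) :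
    maskProd R B (m + n) ξ = maskProd R B m ξ * maskProd R B n ((invAct R.transpose ^ m) ξ) := by
  rw [maskProd, Finset.prod_range_add]
  congr 1
  refine Finset.prod_congr rfl fun j _ => ?_
  rw [← mul_apply_eq_comp, ← pow_add]
  congr 3; ring

theorem maskProd_zero {d : ℕ} (R : Matrix (Fin d) (Fin d) ℤ) {B : Finset (Fin d → ℤ)}
    (hB : B.Nonempty) (m : ℕ) : maskProd R B m 0 = 1 := by
  simp [maskProd, mask_zero hB]

theorem invAct_pow_intVec_mulVec {d : ℕ} {M : Matrix (Fin d) (Fin d) ℤ} (hM : M.det ≠ 0)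
    (m : ℕ) (v : Fin d → ℤ) : (invAct M ^ m) (intVec ((M ^ m).mulVec v)) = intVec v := by
  rw [intVec_mulVec, ← invAct_pow, invAct_matAct]
  rw [Matrix.det_pow]; exact pow_ne_zero _ hM

/-- For `j ≤ m` the vector `(Rᵀ)^{m-j} v` is still integral, and the mask is `ℤ^d`-periodic. Hence
later blocks do not disturb earlier factors. -/
theorem maskProd_add_intVec {d : ℕ} {R : Matrix (Fin d) (Fin d) ℤ} (hR : R.det ≠ 0)
    (B : Finset (Fin d → ℤ)) (m : ℕ) (ξ : EuclideanSpace ℝ (Fin d)) (v : Fin d → ℤ) :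
    maskProd R B m (ξ + intVec ((R.transpose ^ m).mulVec v)) = maskProd R B m ξ := by
  refine Finset.prod_congr rfl fun j hj => ?_
  have hj' : m = (j + 1) + (m - (j + 1)) := by
    have := Finset.mem_range.1 hj
    omega
  rw [map_add]
  conv_lhs => rw [hj']
  rw [pow_add (R.transpose), ← Matrix.mulVec_mulVec, invAct_pow_intVec_mulVec, mask_add_intVec]
  rw [Matrix.det_transpose]; exact hR

/-! ### The Fourier transform of the self-affine measure -/

theorem fourierMeasure_eq_integral_expChar {d : ℕ} (μ : Measure (EuclideanSpace ℝ (Fin d)))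
    (ξ : EuclideanSpace ℝ (Fin d)) : fourierMeasure μ ξ = ∫ x, expChar (-ξ) x ∂μ := by
  refine integral_congr_ae (ae_of_all _ fun x => ?_)
  simp only [expChar, inner_neg_left]
  congr 1; push_cast; ring

theorem charFun_eq_integral_expChar {d : ℕ} (μ : Measure (EuclideanSpace ℝ (Fin d)))
    (ξ : EuclideanSpace ℝ (Fin d)) :
    charFun μ ξ = ∫ x, expChar ((2 * Real.pi)⁻¹ • ξ) x ∂μ := by
  rw [charFun_apply]
  refine integral_congr_ae (ae_of_all _ fun x => ?_)
  simp only [expChar, real_inner_smul_left, real_inner_comm ξ x]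
  congr 1
  have : (Real.pi : ℂ) ≠ 0 := by exact_mod_cast Real.pi_ne_zero
  push_cast
  field_simp

theorem fourierMeasure_eq_charFun {d : ℕ} (μ : Measure (EuclideanSpace ℝ (Fin d)))
    (ξ : EuclideanSpace ℝ (Fin d)) :
    fourierMeasure μ ξ = charFun μ ((2 * Real.pi) • -ξ) := by
  rw [fourierMeasure_eq_integral_expChar, charFun_eq_integral_expChar, smul_smul,
    inv_mul_cancel₀ (by positivity), one_smul]

theorem fourierMeasure_zero {d : ℕ} (μ : Measure (EuclideanSpace ℝ (Fin d)))
    [IsProbabilityMeasure μ] : fourierMeasure μ 0 = 1 := by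
  simp [fourierMeasure_eq_integral_expChar, expChar_zero_left]

theorem norm_fourierMeasure_le_one {d : ℕ} (μ : Measure (EuclideanSpace ℝ (Fin d)))
    [IsProbabilityMeasure μ] (ξ : EuclideanSpace ℝ (Fin d)) : ‖fourierMeasure μ ξ‖ ≤ 1 := by
  rw [fourierMeasure_eq_charFun]
  exact norm_charFun_le_one _

theorem continuous_fourierMeasure {d : ℕ} (μ : Measure (EuclideanSpace ℝ (Fin d)))
    [IsProbabilityMeasure μ] : Continuous (fourierMeasure μ) := by
  have : fourierMeasure μ = fun ξ => charFun μ ((2 * Real.pi) • -ξ) :=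
    funext (fourierMeasure_eq_charFun μ)
  rw [this]
  fun_prop

theorem integrable_expChar {d : ℕ} (μ : Measure (EuclideanSpace ℝ (Fin d)))
    [IsFiniteMeasure μ] (ξ : EuclideanSpace ℝ (Fin d)) : Integrable (expChar ξ) μ :=
  Integrable.of_bound (C := 1) (by fun_prop) (ae_of_all _ fun x => (norm_expChar ξ x).le)

/-- The bound does not depend on `ζ`: this is the uniformity over `λ ∈ Λ_k` needed for the
domination. -/
theorem norm_fourierMeasure_add_sub_le {d : ℕ} (μ : Measure (EuclideanSpace ℝ (Fin d)))
    [IsFiniteMeasure μ] (η ζ : EuclideanSpace ℝ (Fin d)) :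
    ‖fourierMeasure μ (η + ζ) - fourierMeasure μ ζ‖ ≤ ∫ x, ‖expChar (-η) x - 1‖ ∂μ := by
  rw [fourierMeasure_eq_integral_expChar, fourierMeasure_eq_integral_expChar,
    ← integral_sub (integrable_expChar _ _) (integrable_expChar _ _)]
  refine (norm_integral_le_integral_norm _).trans (le_of_eq ?_)
  refine integral_congr_ae (ae_of_all _ fun x => ?_)
  simp only [neg_add, expChar_add_left]
  rw [← sub_one_mul, norm_mul, norm_expChar, mul_one]

theorem tendsto_integral_norm_expChar_sub_one {d : ℕ}
    (μ : Measure (EuclideanSpace ℝ (Fin d))) [IsFiniteMeasure μ]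
    {η : ℕ → EuclideanSpace ℝ (Fin d)} (hη : Tendsto η atTop (𝓝 0)) :
    Tendsto (fun k => ∫ x, ‖expChar (-η k) x - 1‖ ∂μ) atTop (𝓝 0) := by
  have h0 : (0 : ℝ) = ∫ _, (0 : ℝ) ∂μ := by simp
  rw [h0]
  refine tendsto_integral_of_dominated_convergence (fun _ => 2) (fun k => ?_)
    (integrable_const _) (fun k => ae_of_all _ fun x => ?_) (ae_of_all _ fun x => ?_)
  · exact Continuous.aestronglyMeasurable (by fun_prop)
  · rw [norm_norm]
    refine (norm_sub_le _ _).trans ?_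
    rw [norm_expChar, norm_one]; norm_num
  · have hc : Continuous fun y => ‖expChar x (-y) - 1‖ := by fun_prop
    have := (hc.tendsto 0).comp hη
    simp only [neg_zero, expChar_comm x 0, expChar_zero_left, sub_self, norm_zero] at this
    refine this.congr fun k => ?_
    simp only [Function.comp_apply, expChar_comm x]

theorem IsSelfAffineMeasure.fourierMeasure_eq {d : ℕ} {R : Matrix (Fin d) (Fin d) ℤ}
    {B : Finset (Fin d → ℤ)} {μ : Measure (EuclideanSpace ℝ (Fin d))}
    (hμ : IsSelfAffineMeasure R B μ) (ξ : EuclideanSpace ℝ (Fin d)) :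
    fourierMeasure μ ξ =
      mask B (invAct R.transpose ξ) * fourierMeasure μ (invAct R.transpose ξ) := by
  have := hμ.prob
  -- For empty `B` the invariance would give total mass zero.
  have hB : (B.card : ENNReal) ≠ 0 := by
    intro h
    have h0 : B = ∅ := by simpa using h
    have := hμ.invariant Set.univ MeasurableSet.univ
    simp [h0] at this
  have hμ' : μ = ∑ b ∈ B, (B.card : ENNReal)⁻¹ • μ.map (ifsMap R b) := by
    ext E hE
    rw [hμ.invariant E hE]
    simp only [Measure.finsetSum_apply, Measure.smul_apply, smul_eq_mul]
    refine Finset.sum_congr rfl fun b _ => ?_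
    rw [Measure.map_apply (measurable_ifsMap R b) hE]
  have hint : ∀ b, Integrable (expChar (-ξ)) (μ.map (ifsMap R b)) := by
    intro b
    have : IsProbabilityMeasure (μ.map (ifsMap R b)) :=
      Measure.isProbabilityMeasure_map (measurable_ifsMap R b).aemeasurable
    exact integrable_expChar _ _
  have hone : ∀ b, ∫ x, expChar (-ξ) x ∂(μ.map (ifsMap R b)) =
      expChar (intVec b) (-invAct R.transpose ξ) * fourierMeasure μ (invAct R.transpose ξ) := by
    intro b
    rw [integral_map (measurable_ifsMap R b).aemeasurable (by fun_prop),
      fourierMeasure_eq_integral_expChar, ← integral_const_mul]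
    refine integral_congr_ae (ae_of_all _ fun x => ?_)
    simp only [ifsMap]
    rw [expChar_comm (intVec b), ← expChar_add, ← map_neg, add_comm x, expChar, expChar,
      real_inner_comm, inner_invAct_left, real_inner_comm]
  conv_lhs => rw [fourierMeasure_eq_integral_expChar, hμ']
  rw [integral_finsetSum_measure fun b _ => (hint b).smul_measure (ENNReal.inv_ne_top.2 hB)]
  simp only [integral_smul_measure, hone]
  rw [mask, Finset.mul_sum, Finset.sum_mul]
  refine Finset.sum_congr rfl fun b _ => ?_
  simp [mul_assoc]

theorem IsSelfAffineMeasure.fourierMeasure_eq_maskProd {d : ℕ} {R : Matrix (Fin d) (Fin d) ℤ}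
    {B : Finset (Fin d → ℤ)} {μ : Measure (EuclideanSpace ℝ (Fin d))}
    (hμ : IsSelfAffineMeasure R B μ) (m : ℕ) (ξ : EuclideanSpace ℝ (Fin d)) :
    fourierMeasure μ ξ =
      maskProd R B m ξ * fourierMeasure μ ((invAct R.transpose ^ m) ξ) := by
  induction m with
  | zero => simp [maskProd]
  | succ m ih =>
    rw [ih, hμ.fourierMeasure_eq, maskProd, maskProd, Finset.prod_range_succ, pow_succ',
      mul_apply_eq_comp, mul_assoc]

/-! ### Uniqueness of Fourier transforms of integrable functions -/

/-- A real integrable function is determined by its Fourier transform. -/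
theorem ae_eq_zero_of_integral_expChar_mul_ofReal {d : ℕ}
    {μ : Measure (EuclideanSpace ℝ (Fin d))} {g : EuclideanSpace ℝ (Fin d) → ℝ}
    (hg : Integrable g μ) (h : ∀ ξ, ∫ x, expChar ξ x * (g x : ℂ) ∂μ = 0) : g =ᵐ[μ] 0 := by
  wlog hgm : Measurable g generalizing g
  · have hae := hg.1.ae_eq_mk
    refine hae.trans (this (hg.congr hae) (fun ξ => ?_) hg.1.stronglyMeasurable_mk.measurable)
    rw [← h ξ]
    refine integral_congr_ae ?_
    filter_upwards [hae] with x hx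
    rw [hx]
  have hp : Integrable (fun x => ((g x).toNNReal : ℝ)) μ := hg.real_toNNReal
  have hm : Integrable (fun x => ((-g x).toNNReal : ℝ)) μ := hg.neg.real_toNNReal
  have fin_of : ∀ {f : EuclideanSpace ℝ (Fin d) → ℝ}, Integrable (fun x => ((f x).toNNReal : ℝ)) μ →
      ∫⁻ x, ((f x).toNNReal : ENNReal) ∂μ ≠ ⊤ := by
    intro f hf
    have := hf.2
    rw [HasFiniteIntegral] at this
    refine ne_of_eq_of_ne (lintegral_congr fun x => ?_) this.ne
    rw [enorm_eq_nnnorm, NNReal.nnnorm_eq]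
  have finp := fin_of (f := g) hp
  have finm := fin_of (f := fun x => -g x) hm
  have i1 := isFiniteMeasure_withDensity finp
  have i2 := isFiniteMeasure_withDensity finm
  have hmul : ∀ {f : EuclideanSpace ℝ (Fin d) → ℝ} (ξ), Integrable f μ →
      Integrable (fun x => expChar ξ x * (f x : ℂ)) μ := by
    intro f ξ hf
    exact hf.ofReal.bdd_mul (c := 1) (by fun_prop) (ae_of_all _ fun x => (norm_expChar ξ x).le)
  -- The finite measures `g⁺ μ` and `g⁻ μ` have the same characteristic function, hence coincide,
  -- and so do their densities.
  have heq : μ.withDensity (fun x => ((g x).toNNReal : ENNReal)) =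
      μ.withDensity (fun x => ((-g x).toNNReal : ENNReal)) := by
    refine Measure.ext_of_charFun (funext fun ξ => ?_)
    rw [charFun_eq_integral_expChar, charFun_eq_integral_expChar,
      integral_withDensity_eq_integral_smul (by fun_prop),
      integral_withDensity_eq_integral_smul (by fun_prop), ← sub_eq_zero]
    set η := (2 * Real.pi)⁻¹ • ξ
    rw [← h η]
    have e : ∀ (r : NNReal) (z : ℂ), r • z = z * ((r : ℝ) : ℂ) := by
      intro r z; rw [NNReal.smul_def, Complex.real_smul, mul_comm]
    simp only [e]
    rw [← integral_sub (hmul _ hp) (hmul _ hm)]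
    refine integral_congr_ae (ae_of_all _ fun x => ?_)
    simp only
    rw [← mul_sub, ← Complex.ofReal_sub, Real.coe_toNNReal', Real.coe_toNNReal']
    congr 2
    rcases le_total 0 (g x) with h0 | h0
    · rw [max_eq_left h0, max_eq_right (by linarith)]; ring
    · rw [max_eq_right h0, max_eq_left (by linarith)]; ring
  rw [withDensity_eq_iff (by fun_prop) (by fun_prop) finp] at heq
  filter_upwards [heq] with x hx
  have hx' : (g x).toNNReal = (-g x).toNNReal := by exact_mod_cast hx
  have hx2 := congrArg NNReal.toReal hx'
  rw [Real.coe_toNNReal', Real.coe_toNNReal'] at hx2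
  rcases le_total 0 (g x) with h0 | h0
  · rw [max_eq_left h0, max_eq_right (by linarith)] at hx2; simpa using hx2
  · rw [max_eq_right h0, max_eq_left (by linarith)] at hx2
    simp only [Pi.zero_apply]; linarith

/-- Replacing `ξ` by `-ξ` shows that the conjugate of `f` also has zero transform; hence so do the
real and imaginary parts. -/
theorem ae_eq_zero_of_integral_expChar_mul {d : ℕ}
    {μ : Measure (EuclideanSpace ℝ (Fin d))} {f : EuclideanSpace ℝ (Fin d) → ℂ}
    (hf : Integrable f μ) (h : ∀ ξ, ∫ x, expChar ξ x * f x ∂μ = 0) : f =ᵐ[μ] 0 := by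
  have hI : ∀ ξ, Integrable (fun x => expChar ξ x * f x) μ := fun ξ =>
    hf.bdd_mul (c := 1) (by fun_prop) (ae_of_all _ fun x => (norm_expChar ξ x).le)
  have hcf : Integrable (fun x => (starRingEnd ℂ) (f x)) μ :=
    (Complex.conjCLE.integrable_comp_iff).2 hf
  have hIc : ∀ ξ, Integrable (fun x => expChar ξ x * (starRingEnd ℂ) (f x)) μ := fun ξ =>
    hcf.bdd_mul (c := 1) (by fun_prop) (ae_of_all _ fun x => (norm_expChar ξ x).le)
  have hconj : ∀ ξ, ∫ x, expChar ξ x * (starRingEnd ℂ) (f x) ∂μ = 0 := by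
    intro ξ
    have : ∀ x, expChar ξ x * (starRingEnd ℂ) (f x) = (starRingEnd ℂ) (expChar (-ξ) x * f x) := by
      intro x; rw [map_mul, expChar_neg_left, Complex.conj_conj]
    simp only [this]
    rw [integral_conj, h, map_zero]
  have hre : (fun x => (f x).re) =ᵐ[μ] 0 := by
    refine ae_eq_zero_of_integral_expChar_mul_ofReal hf.re fun ξ => ?_
    have : ∀ x, expChar ξ x * ((f x).re : ℂ) =
        2⁻¹ * (expChar ξ x * f x + expChar ξ x * (starRingEnd ℂ) (f x)) := by
      intro x; rw [Complex.re_eq_add_conj]; ring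
    simp only [this]
    rw [integral_const_mul, integral_add (hI ξ) (hIc ξ), h, hconj]; simp
  have him : (fun x => (f x).im) =ᵐ[μ] 0 := by
    refine ae_eq_zero_of_integral_expChar_mul_ofReal hf.im fun ξ => ?_
    have : ∀ x, expChar ξ x * ((f x).im : ℂ) =
        (2 * Complex.I)⁻¹ * (expChar ξ x * f x - expChar ξ x * (starRingEnd ℂ) (f x)) := by
      intro x; rw [Complex.im_eq_sub_conj]; field_simp
    simp only [this]
    rw [integral_const_mul, integral_sub (hI ξ) (hIc ξ), h, hconj]; simp
  filter_upwards [hre, him] with x h1 h2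
  exact Complex.ext h1 h2

/-! ### Exponentials in `L²(μ)` and the Jorgensen–Pedersen criterion -/

theorem memLp_expChar {d : ℕ} (μ : Measure (EuclideanSpace ℝ (Fin d))) [IsFiniteMeasure μ]
    (ξ : EuclideanSpace ℝ (Fin d)) : MemLp (expChar ξ) 2 μ :=
  MemLp.of_bound (by fun_prop) 1 (ae_of_all _ fun x => (norm_expChar ξ x).le)

/-- The character `x ↦ exp (2 π i ⟨ξ, x⟩)` as an element of `L²(μ)`. -/
def expLp {d : ℕ} (μ : Measure (EuclideanSpace ℝ (Fin d))) [IsFiniteMeasure μ]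
    (ξ : EuclideanSpace ℝ (Fin d)) : Lp ℂ 2 μ :=
  (memLp_expChar μ ξ).toLp _

theorem inner_expLp {d : ℕ} (μ : Measure (EuclideanSpace ℝ (Fin d))) [IsFiniteMeasure μ]
    (ξ : EuclideanSpace ℝ (Fin d)) (f : Lp ℂ 2 μ) :
    inner ℂ (expLp μ ξ) f = ∫ x, expChar (-ξ) x * f x ∂μ := by
  rw [L2.inner_def]
  refine integral_congr_ae ?_
  filter_upwards [(memLp_expChar μ ξ).coeFn_toLp] with x hx
  rw [expLp, hx, expChar_neg_left, RCLike.inner_apply, mul_comm]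

theorem inner_expLp_expLp {d : ℕ} (μ : Measure (EuclideanSpace ℝ (Fin d))) [IsFiniteMeasure μ]
    (ξ η : EuclideanSpace ℝ (Fin d)) :
    inner ℂ (expLp μ ξ) (expLp μ η) = fourierMeasure μ (ξ - η) := by
  rw [inner_expLp, fourierMeasure_eq_integral_expChar]
  refine integral_congr_ae ?_
  filter_upwards [(memLp_expChar μ η).coeFn_toLp] with x hx
  rw [expLp, hx, ← expChar_add_left, neg_sub, neg_add_eq_sub]

theorem norm_expLp {d : ℕ} (μ : Measure (EuclideanSpace ℝ (Fin d))) [IsProbabilityMeasure μ]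
    (ξ : EuclideanSpace ℝ (Fin d)) : ‖expLp μ ξ‖ = 1 := by
  have h := inner_self_eq_norm_sq_to_K (𝕜 := ℂ) (expLp μ ξ)
  rw [inner_expLp_expLp, sub_self, fourierMeasure_zero] at h
  have h' : (1 : ℝ) = ‖expLp μ ξ‖ ^ 2 := by
    have h2 : ((1 : ℝ) : ℂ) = ((‖expLp μ ξ‖ ^ 2 : ℝ) : ℂ) := by simpa using h
    exact_mod_cast h2
  nlinarith [norm_nonneg (expLp μ ξ)]

/-- A vector for which Bessel's inequality is an equality is orthogonal to every vector
orthogonal to the orthonormal family. -/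
theorem Orthonormal.inner_eq_zero_of_norm_sq_le_tsum {𝕜 E ι : Type*} [RCLike 𝕜]
    [NormedAddCommGroup E] [InnerProductSpace 𝕜 E] {v : ι → E} (hv : Orthonormal 𝕜 v) {x f : E}
    (hx : ‖x‖ ^ 2 ≤ ∑' i, ‖inner 𝕜 (v i) x‖ ^ 2) (hf : ∀ i, inner 𝕜 (v i) f = 0) :
    inner 𝕜 x f = 0 := by
  have hs := (hv.inner_products_summable x).hasSum
  have hnorm : ∀ s : Finset ι, ‖x - ∑ i ∈ s, inner 𝕜 (v i) x • v i‖ ^ 2 =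
      ‖x‖ ^ 2 - ∑ i ∈ s, ‖inner 𝕜 (v i) x‖ ^ 2 := by
    intro s
    set y := ∑ i ∈ s, inner 𝕜 (v i) x • v i with hy
    have hxy : inner 𝕜 x y = ((∑ i ∈ s, ‖inner 𝕜 (v i) x‖ ^ 2 : ℝ) : 𝕜) := by
      rw [hy, inner_sum]
      push_cast
      refine Finset.sum_congr rfl fun i _ => ?_
      rw [inner_smul_right, ← inner_conj_symm x, RCLike.mul_conj]
    have hyy : inner 𝕜 y y = ((∑ i ∈ s, ‖inner 𝕜 (v i) x‖ ^ 2 : ℝ) : 𝕜) := by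
      rw [hy, hv.inner_sum]
      push_cast
      refine Finset.sum_congr rfl fun i _ => ?_
      rw [RCLike.conj_mul]
    rw [@norm_sub_sq 𝕜, hxy, InnerProductSpace.norm_sq_eq_re_inner (𝕜 := 𝕜) y, hyy,
      RCLike.ofReal_re]
    ring
  have hle : ∀ s : Finset ι, ‖inner 𝕜 x f‖ ^ 2 ≤
      (‖x‖ ^ 2 - ∑ i ∈ s, ‖inner 𝕜 (v i) x‖ ^ 2) * ‖f‖ ^ 2 := by
    intro s
    -- As `f` is orthogonal to the partial sum, `x` may be replaced by the residual. Cauchy–Schwarz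
    -- then applies, and the limiting residual is zero by `hx`.
    have h1 : inner 𝕜 x f = inner 𝕜 (x - ∑ i ∈ s, inner 𝕜 (v i) x • v i) f := by
      simp [inner_sub_left, sum_inner, inner_smul_left, hf]
    rw [← hnorm, ← mul_pow, h1]
    exact pow_le_pow_left₀ (norm_nonneg _) (norm_inner_le_norm _ _) 2
  have hlim := ge_of_tendsto ((hs.const_sub (‖x‖ ^ 2)).mul_const (‖f‖ ^ 2))
    (Eventually.of_forall hle)
  have h2 : ‖inner 𝕜 x f‖ ^ 2 ≤ 0 :=
    hlim.trans (mul_nonpos_of_nonpos_of_nonneg (by linarith) (by positivity))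
  have h3 : ‖inner 𝕜 x f‖ = 0 := pow_eq_zero_iff two_ne_zero |>.1 (le_antisymm h2 (by positivity))
  exact norm_eq_zero.1 h3

theorem orthonormal_expLp {d : ℕ} {μ : Measure (EuclideanSpace ℝ (Fin d))}
    [IsProbabilityMeasure μ] {Λ : Set (EuclideanSpace ℝ (Fin d))}
    (horth : ∀ x ∈ Λ, ∀ y ∈ Λ, x ≠ y → fourierMeasure μ (x - y) = 0) :
    Orthonormal ℂ fun l : Λ => expLp μ l.1 := by
  refine ⟨fun l => norm_expLp μ l.1, fun l l' hne => ?_⟩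
  change inner ℂ (expLp μ l.1) (expLp μ l'.1) = 0
  rw [inner_expLp_expLp]
  exact horth _ l.2 _ l'.2 (fun h => hne (Subtype.ext h))

/-- The Jorgensen–Pedersen criterion: mutually orthogonal exponentials form an orthonormal basis
if `∑_{λ ∈ Λ} |μ̂(ξ + λ)|² = 1` for all `ξ`. -/
theorem isSpectrum_of_one_le_tsum {d : ℕ} {μ : Measure (EuclideanSpace ℝ (Fin d))}
    [IsProbabilityMeasure μ] {Λ : Set (EuclideanSpace ℝ (Fin d))}
    (horth : ∀ x ∈ Λ, ∀ y ∈ Λ, x ≠ y → fourierMeasure μ (x - y) = 0)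
    (hsum : ∀ ξ, 1 ≤ ∑' l : Λ, ‖fourierMeasure μ (ξ + l.1)‖ ^ 2) : IsSpectrum μ Λ := by
  have hon := orthonormal_expLp horth
  have hbot : (Submodule.span ℂ (Set.range fun l : Λ => expLp μ l.1))ᗮ = ⊥ := by
    rw [Submodule.eq_bot_iff]
    intro f hf
    have hf' : ∀ l : Λ, inner ℂ (expLp μ l.1) f = 0 := fun l =>
      (Submodule.mem_orthogonal _ _).1 hf _ (Submodule.subset_span ⟨l, rfl⟩)
    -- `hsum` gives equality in Bessel's inequality for every exponential, so `f` is orthogonal to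
    -- all of them and not only to those of `Λ`.
    have hall : ∀ ξ, ∫ x, expChar ξ x * f x ∂μ = 0 := by
      intro ξ
      have h := hon.inner_eq_zero_of_norm_sq_le_tsum (x := expLp μ (-ξ)) (f := f) (by
        rw [norm_expLp, one_pow]
        simpa only [inner_expLp_expLp, sub_neg_eq_add, add_comm] using hsum ξ) hf'
      rwa [inner_expLp, neg_neg] at h
    have hint : Integrable f μ := (Lp.memLp f).integrable (by norm_num)
    exact (Lp.eq_zero_iff_ae_eq_zero).2 (ae_eq_zero_of_integral_expChar_mul hint hall)
  refine ⟨HilbertBasis.mkOfOrthogonalEqBot hon hbot, fun l => ?_⟩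
  rw [HilbertBasis.coe_mkOfOrthogonalEqBot]
  exact (memLp_expChar μ l.1).coeFn_toLp

theorem summable_norm_fourierMeasure_add_sq {d : ℕ} {μ : Measure (EuclideanSpace ℝ (Fin d))}
    [IsProbabilityMeasure μ] {Λ : Set (EuclideanSpace ℝ (Fin d))}
    (horth : ∀ x ∈ Λ, ∀ y ∈ Λ, x ≠ y → fourierMeasure μ (x - y) = 0)
    (ξ : EuclideanSpace ℝ (Fin d)) :
    Summable fun l : Λ => ‖fourierMeasure μ (ξ + l.1)‖ ^ 2 := by
  have h := (orthonormal_expLp horth).inner_products_summable (expLp μ (-ξ))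
  simpa only [inner_expLp_expLp, sub_neg_eq_add, add_comm] using h

/-! The sets `Λ_k`. -/

theorem mem_concatBlocks {d : ℕ} {R : Matrix (Fin d) (Fin d) ℤ} {n : ℕ → ℕ}
    {J : ℕ → Finset (Fin d → ℤ)} {k : ℕ} {x : Fin d → ℤ} : x ∈ concatBlocks R n J k ↔
      ∃ j : Fin k → Fin d → ℤ, (∀ i : Fin k, j i ∈ J i) ∧
        ∑ i : Fin k, (R.transpose ^ partialLen n i).mulVec (j i) = x := by
  simp [concatBlocks]

theorem concatBlocks_zero {d : ℕ} (R : Matrix (Fin d) (Fin d) ℤ) (n : ℕ → ℕ)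
    (J : ℕ → Finset (Fin d → ℤ)) : concatBlocks R n J 0 = {0} := by
  ext x
  simp [mem_concatBlocks, eq_comm]

/-- The last block is split off, matching the factorization of the mask product at `m_k`. -/
theorem concatBlocks_succ {d : ℕ} (R : Matrix (Fin d) (Fin d) ℤ) (n : ℕ → ℕ)
    (J : ℕ → Finset (Fin d → ℤ)) (k : ℕ) : concatBlocks R n J (k + 1) =
      (concatBlocks R n J k ×ˢ J k).image fun p =>
        p.1 + (R.transpose ^ partialLen n k).mulVec p.2 := by
  ext x
  simp only [Finset.mem_image, Finset.mem_product, mem_concatBlocks, Prod.exists]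
  constructor
  · rintro ⟨j, hj, rfl⟩
    refine ⟨_, j (Fin.last k), ⟨⟨fun i => j i.castSucc, fun i => by simpa using hj i.castSucc, rfl⟩,
      by simpa using hj (Fin.last k)⟩, ?_⟩
    rw [Fin.sum_univ_castSucc]
    simp
  · rintro ⟨y, z, ⟨⟨j, hj, rfl⟩, hz⟩, rfl⟩
    refine ⟨Fin.snoc (α := fun _ => Fin d → ℤ) j z, fun i => ?_, ?_⟩
    · refine Fin.lastCases ?_ (fun i => ?_) i
      · simpa using hz
      · simpa using hj i
    · rw [Fin.sum_univ_castSucc]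
      simp

/-- Padding by the digit `0` makes the `Λ_k` nested: two frequencies lie in a common `Λ_k`, and each
frequency lies in all later ones. -/
theorem concatBlocks_mono {d : ℕ} {R : Matrix (Fin d) (Fin d) ℤ} {n : ℕ → ℕ}
    {J : ℕ → Finset (Fin d → ℤ)} (hJ0 : ∀ k, 0 ∈ J k) : Monotone (concatBlocks R n J) := by
  refine monotone_nat_of_le_succ fun k x hx => ?_
  rw [concatBlocks_succ]
  exact Finset.mem_image.2 ⟨(x, 0), Finset.mem_product.2 ⟨hx, hJ0 k⟩, by simp⟩

theorem eq_zero_of_sum_eq_single_term {ι : Type*} {s : Finset ι} {F : ι → ℝ}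
    (hF : ∀ i, 0 ≤ F i) {i j : ι} (hi : i ∈ s) (hj : j ∈ s) (hij : i ≠ j)
    (hsum : ∑ k ∈ s, F k = F j) : F i = 0 := by
  classical
  rw [← Finset.add_sum_erase s F hj] at hsum
  have h0 : ∑ k ∈ s.erase j, F k = 0 := by linarith
  exact (Finset.sum_eq_zero_iff_of_nonneg fun k _ => hF k).1 h0 i
    (Finset.mem_erase.2 ⟨hij, hi⟩)

/-- By induction on blocks: the first `m_k` factors ignore the new block by periodicity, and the
last `n_k` factors form the mask of `B_{n_k}`, whose squares sum to one over `J k`. -/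
theorem sum_norm_maskProd_concatBlocks {d : ℕ} {R : Matrix (Fin d) (Fin d) ℤ}
    {B L : Finset (Fin d → ℤ)} (hRBL : IsHadamardTriple R B L) (hB : B.Nonempty) {n : ℕ → ℕ}
    {J : ℕ → Finset (Fin d → ℤ)}
    (hJ : ∀ k, IsHadamardTriple (R ^ n k) (digitSums R B (n k)) (J k)) (k : ℕ) :
    ∀ ξ, ∑ l ∈ concatBlocks R n J k, ‖maskProd R B (partialLen n k) (ξ + intVec l)‖ ^ 2 = 1 := by
  have hdet := hRBL.expansive.det_ne_zero
  have hdetT : R.transpose.det ≠ 0 := by rwa [Matrix.det_transpose]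
  induction k with
  | zero => intro ξ; simp [concatBlocks_zero, partialLen, maskProd]
  | succ k ih =>
    set m := partialLen n k with hm
    have hlen : partialLen n (k + 1) = m + n k := Finset.sum_range_succ _ _
    set φ : (Fin d → ℤ) × (Fin d → ℤ) → Fin d → ℤ := fun p =>
      p.1 + (R.transpose ^ m).mulVec p.2 with hφ
    have hterm : ∀ ξ (p : (Fin d → ℤ) × (Fin d → ℤ)),
        maskProd R B (partialLen n (k + 1)) (ξ + intVec (φ p)) =
        maskProd R B m (ξ + intVec p.1) * mask (digitSums R B (n k))
          (invAct (R ^ n k).transpose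
            ((invAct R.transpose ^ m) (ξ + intVec p.1) + intVec p.2)) := by
      intro ξ p
      rw [hlen, maskProd_add, hφ]
      simp only
      rw [intVec_add, ← add_assoc, maskProd_add_intVec hdet, map_add,
        invAct_pow_intVec_mulVec hdetT, Matrix.transpose_pow, invAct_pow, hRBL.mask_digitSums]
    have hprod : ∀ ξ, ∑ p ∈ concatBlocks R n J k ×ˢ J k,
        ‖maskProd R B (partialLen n (k + 1)) (ξ + intVec (φ p))‖ ^ 2 = 1 := by
      intro ξ
      rw [Finset.sum_product, ← ih ξ]
      refine Finset.sum_congr rfl fun l _ => ?_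
      simp only [hterm, norm_mul, mul_pow]
      rw [← Finset.mul_sum, (hJ k).sum_norm_mask_sq (digitSums_nonempty R hB _), mul_one]
    -- At `ξ = -φ q` the term of `q` exhausts the total sum `1`, so a second pair with the same
    -- image, whose term would also be `1`, cannot exist.
    have hinj : Set.InjOn φ (concatBlocks R n J k ×ˢ J k : Finset _) := by
      intro p hp q hq hpq
      by_contra hne
      have h1 : ‖maskProd R B (partialLen n (k + 1)) (-intVec (φ q) + intVec (φ q))‖ ^ 2 = 1 := by
        rw [neg_add_cancel, maskProd_zero R hB]; simp
      have h0 := eq_zero_of_sum_eq_single_term (F := fun p =>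
        ‖maskProd R B (partialLen n (k + 1)) (-intVec (φ q) + intVec (φ p))‖ ^ 2)
        (fun _ => by positivity) hp hq hne ((hprod _).trans h1.symm)
      simp only [hpq] at h0
      rw [h1] at h0
      exact one_ne_zero h0
    intro ξ
    rw [concatBlocks_succ, Finset.sum_image hinj]
    exact hprod ξ

theorem maskProd_sub_eq_zero {d : ℕ} {R : Matrix (Fin d) (Fin d) ℤ}
    {B L : Finset (Fin d → ℤ)} (hRBL : IsHadamardTriple R B L) (hB : B.Nonempty) {n : ℕ → ℕ}
    {J : ℕ → Finset (Fin d → ℤ)}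
    (hJ : ∀ k, IsHadamardTriple (R ^ n k) (digitSums R B (n k)) (J k)) {k : ℕ}
    {x y : Fin d → ℤ} (hx : x ∈ concatBlocks R n J k) (hy : y ∈ concatBlocks R n J k)
    (hxy : x ≠ y) : maskProd R B (partialLen n k) (intVec x - intVec y) = 0 := by
  have h1 : ‖maskProd R B (partialLen n k) (-intVec y + intVec y)‖ ^ 2 = 1 := by
    rw [neg_add_cancel, maskProd_zero R hB]; simp
  have h0 := eq_zero_of_sum_eq_single_term (F := fun l =>
    ‖maskProd R B (partialLen n k) (-intVec y + intVec l)‖ ^ 2) (fun _ => by positivity)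
    hx hy hxy ((sum_norm_maskProd_concatBlocks hRBL hB hJ k _).trans h1.symm)
  simpa [neg_add_eq_sub] using h0

/-! ### The lower bound `δ(Λ)` and the passage to the limit -/

theorem deltaLower_le {d : ℕ} (μ : Measure (EuclideanSpace ℝ (Fin d)))
    (R : Matrix (Fin d) (Fin d) ℤ) (n : ℕ → ℕ) (J : ℕ → Finset (Fin d → ℤ)) {k : ℕ}
    {l : Fin d → ℤ} (hl : l ∈ concatBlocks R n J (k + 1)) :
    deltaLower μ R n J ≤
      ‖fourierMeasure μ ((invAct R.transpose ^ partialLen n (k + 1)) (intVec l))‖ ^ 2 := by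
  rw [← invAct_pow]
  -- Real infima need a lower bound, here `0`, at both levels.
  refine (ciInf_le ⟨0, ?_⟩ k).trans (ciInf_le ⟨0, ?_⟩ (⟨l, hl⟩ : concatBlocks R n J (k + 1)))
  · rintro _ ⟨k, rfl⟩
    exact Real.iInf_nonneg fun _ => by positivity
  · rintro _ ⟨k, rfl⟩
    simp only
    positivity

theorem partialLen_ge {n : ℕ → ℕ} (hn : ∀ k, 0 < n k) (k : ℕ) : k ≤ partialLen n k := by
  induction k with
  | zero => simp
  | succ k ih =>
    rw [partialLen, Finset.sum_range_succ, ← partialLen]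
    have := hn k
    omega

theorem mainTheorem4 {d : ℕ} (R : Matrix (Fin d) (Fin d) ℤ) (B L : Finset (Fin d → ℤ))
    (hRBL : IsHadamardTriple R B L)
    (n : ℕ → ℕ) (hn : ∀ k, 0 < n k)
    (J : ℕ → Finset (Fin d → ℤ))
    (hJ : ∀ k, IsHadamardTriple (R ^ n k) (digitSums R B (n k)) (J k))
    (hJ0 : ∀ k, 0 ∈ J k)
    (hδ : 0 < deltaLower (selfAffineMeasure R B) R n J) :
    IsSpectrum (selfAffineMeasure R B) (intVec '' concatUnion R n J) := by
  classical
  -- `B_{n_1}` has as many elements as `J 0`, which contains `0`; since `n_1 > 0`, its elements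
  -- involve a digit of `B`.
  have hB : B.Nonempty := by
    have h1 : 0 < (digitSums R B (n 0)).card := by
      rw [(hJ 0).card_eq]; exact Finset.card_pos.2 ⟨0, hJ0 0⟩
    obtain ⟨x, hx⟩ := Finset.card_pos.1 h1
    obtain ⟨b, hb, -⟩ := mem_digitSums.1 hx
    exact ⟨_, hb ⟨0, hn 0⟩⟩
  have hμ := isSelfAffineMeasure_selfAffineMeasure hRBL.expansive hB
  set μ := selfAffineMeasure R B with hμdef
  have := hμ.prob
  set T := invAct R.transpose with hT
  set δ := deltaLower μ R n J with hδdef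
  have hmono := concatBlocks_mono (R := R) (n := n) hJ0
  have horth : ∀ x ∈ intVec '' concatUnion R n J, ∀ y ∈ intVec '' concatUnion R n J, x ≠ y →
      fourierMeasure μ (x - y) = 0 := by
    rintro _ ⟨x, hx, rfl⟩ _ ⟨y, hy, rfl⟩ hxy
    obtain ⟨i, hi⟩ := Set.mem_iUnion.1 hx
    obtain ⟨j, hj⟩ := Set.mem_iUnion.1 hy
    have hx' := hmono (le_max_left (i + 1) (j + 1)) hi
    have hy' := hmono (le_max_right (i + 1) (j + 1)) hj
    rw [hμ.fourierMeasure_eq_maskProd (partialLen n (max (i + 1) (j + 1))),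
      maskProd_sub_eq_zero hRBL hB hJ hx' hy' (fun h => hxy (h ▸ rfl)), zero_mul]
  refine isSpectrum_of_one_le_tsum horth fun ξ => ?_
  have hsummable := summable_norm_fourierMeasure_add_sq horth ξ
  set Λ := intVec '' concatUnion R n J with hΛ
  have hm : Tendsto (fun k => partialLen n (k + 1)) atTop atTop :=
    tendsto_atTop_mono (fun k => (Nat.le_succ k).trans (partialLen_ge hn (k + 1))) tendsto_id
  let S : ℕ → Finset (EuclideanSpace ℝ (Fin d)) := fun k => (concatBlocks R n J (k + 1)).image intVec
  have hSmono : Monotone S := fun i j hij => Finset.image_subset_image (hmono (by omega))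
  have hSΛ : ∀ k, (S k : Set _) ⊆ Λ := by
    intro k
    simp only [S, Finset.coe_image]
    exact Set.image_mono (Set.subset_iUnion_of_subset k subset_rfl)
  have hmem : ∀ l : Λ, ∃ k, l.1 ∈ S k := by
    rintro ⟨_, x, hx, rfl⟩
    obtain ⟨i, hi⟩ := Set.mem_iUnion.1 hx
    exact ⟨i, Finset.mem_image_of_mem _ hi⟩
  let P : ℕ → EuclideanSpace ℝ (Fin d) → ℝ := fun k x =>
    ‖maskProd R B (partialLen n (k + 1)) (ξ + x)‖ ^ 2
  -- Extension by zero puts all the sums over `Λ_k` on the single index set `Λ`.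
  let f : ℕ → Λ → ℝ := fun k l => (S k : Set _).indicator (P k) l.1
  have hfsum : ∀ k, ∑' l, f k l = 1 := by
    intro k
    have h1 : ∑' l, f k l = ∑ x ∈ S k, P k x := by
      rw [tsum_subtype Λ ((S k : Set _).indicator (P k)), Set.indicator_indicator,
        Set.inter_eq_self_of_subset_right (hSΛ k), ← tsum_subtype, Finset.tsum_subtype']
    rw [h1, Finset.sum_image intVec_injective.injOn]
    exact sum_norm_maskProd_concatBlocks hRBL hB hJ (k + 1) ξ
  have hTm : ∀ x, Tendsto (fun k => (T ^ partialLen n (k + 1)) x) atTop (𝓝 0) := fun x =>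
    (hRBL.expansive.tendsto_invAct_transpose_pow x).comp hm
  have hfac : ∀ k x, ‖fourierMeasure μ (ξ + x)‖ ^ 2 =
      P k x * ‖fourierMeasure μ ((T ^ partialLen n (k + 1)) (ξ + x))‖ ^ 2 := by
    intro k x
    rw [hμ.fourierMeasure_eq_maskProd (partialLen n (k + 1)) (ξ + x), norm_mul, mul_pow]
  -- the pointwise limit
  have hlim : ∀ l : Λ, Tendsto (fun k => f k l) atTop (𝓝 (‖fourierMeasure μ (ξ + l.1)‖ ^ 2)) := by
    intro l
    obtain ⟨K, hK⟩ := hmem l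
    have h1 : Tendsto (fun k => ‖fourierMeasure μ ((T ^ partialLen n (k + 1)) (ξ + l.1))‖ ^ 2)
        atTop (𝓝 1) := by
      have hc : Continuous fun x => ‖fourierMeasure μ x‖ ^ 2 :=
        (continuous_fourierMeasure μ).norm.pow 2
      have := (hc.tendsto 0).comp (hTm (ξ + l.1))
      rwa [fourierMeasure_zero, norm_one, one_pow] at this
    -- By `hfac`, the mask term is `|μ̂(ξ + λ)|²` divided by a factor tending to `1`; the division
    -- is legitimate once that factor is nonzero.
    have h2 : Tendsto (fun k => ‖fourierMeasure μ (ξ + l.1)‖ ^ 2 *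
        (‖fourierMeasure μ ((T ^ partialLen n (k + 1)) (ξ + l.1))‖ ^ 2)⁻¹) atTop
        (𝓝 (‖fourierMeasure μ (ξ + l.1)‖ ^ 2)) := by
      simpa using (h1.inv₀ one_ne_zero).const_mul (‖fourierMeasure μ (ξ + l.1)‖ ^ 2)
    refine h2.congr' ?_
    filter_upwards [eventually_ge_atTop K, h1.eventually_ne one_ne_zero] with k hk hne
    simp only [f]
    rw [Set.indicator_of_mem (Finset.mem_coe.2 (hSmono hk hK)), hfac k]
    exact mul_inv_cancel_right₀ hne _
  -- the domination
  have hdom : ∀ᶠ k in atTop, ∀ l : Λ, ‖f k l‖ ≤ (2 / δ) * ‖fourierMeasure μ (ξ + l.1)‖ ^ 2 := by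
    have hε := (tendsto_integral_norm_expChar_sub_one μ (hTm ξ)).eventually
      (gt_mem_nhds (show (0 : ℝ) < δ / 4 by positivity))
    filter_upwards [hε] with k hk l
    have hP0 : ∀ x, 0 ≤ P k x := fun x => by positivity
    simp only [f]
    by_cases hl : l.1 ∈ S k
    · rw [Set.indicator_of_mem (Finset.mem_coe.2 hl), Real.norm_of_nonneg (hP0 _), hfac k]
      obtain ⟨x, hx, hxl⟩ := Finset.mem_image.1 hl
      have h1 := deltaLower_le μ R n J hx
      rw [← hδdef, hxl, ← hT] at h1
      have h2 := (norm_fourierMeasure_add_sub_le μ ((T ^ partialLen n (k + 1)) ξ)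
        ((T ^ partialLen n (k + 1)) l.1)).trans hk.le
      rw [← map_add] at h2
      have h3 := norm_fourierMeasure_le_one μ ((T ^ partialLen n (k + 1)) (ξ + l.1))
      have h4 := norm_fourierMeasure_le_one μ ((T ^ partialLen n (k + 1)) l.1)
      have h5 := norm_sub_norm_le (fourierMeasure μ ((T ^ partialLen n (k + 1)) l.1))
        (fourierMeasure μ ((T ^ partialLen n (k + 1)) (ξ + l.1)))
      rw [norm_sub_rev] at h5
      set a := ‖fourierMeasure μ ((T ^ partialLen n (k + 1)) (ξ + l.1))‖
      set b := ‖fourierMeasure μ ((T ^ partialLen n (k + 1)) l.1)‖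
      have ha : 0 ≤ a := norm_nonneg _
      have hb : 0 ≤ b := norm_nonneg _
      -- `b² ≥ δ`, `b - a ≤ δ/4` and `a + b ≤ 2` give `b² - a² ≤ δ/2`; this is where `δ/4` comes
      -- from.
      have hab : δ / 2 ≤ a ^ 2 := by nlinarith
      calc P k l.1 = P k l.1 * (2 / δ * (δ / 2)) := by field_simp
        _ ≤ P k l.1 * (2 / δ * a ^ 2) := by gcongr
        _ = _ := by ring
    · rw [Set.indicator_of_notMem (fun h => hl (Finset.mem_coe.1 h)), norm_zero]
      positivity
  have htsum := tendsto_tsum_of_dominated_convergence (hsummable.mul_left (2 / δ)) hlim hdom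
  simp only [hfsum] at htsum
  exact (tendsto_nhds_unique htsum tendsto_const_nhds).ge

end
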